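/- Let $n\ge 1$, $1<p<\infty$ and $1<\alpha<p$. A domain is a non-empty connected open subset $\Omega\subset\mathbb R^n$, and $C_c^\infty(\Omega)$ denotes the smooth (real- or complex-valued) functions with compact support in $\Omega$. For $x\in\Omega$ and $w\in\mathbb S^{n-1}$ put $$d_{w,\Omega}(x)=\min\{|t| : x+tw\notin\Omega\}\in(0,\infty],$$ where the minimum over the empty set is $\infty$ (and $1/\infty=0$), and define $$\frac{1}{m_\alpha(x)^\alpha}=\frac{\int_{\mathbb S^{n-1}} d_{w,\Omega}(x)^{-\alpha}\,dw}{\int_{\mathbb S^{n-1}}|w_n|^\alpha\,dw},\qquad \mathcal D_{n,p,\alpha}=2\pi^{\frac{n-1}{2}}\,\frac{\Gamma(\frac{1+\alpha}{2})}{\Gamma(\frac{n+\alpha}{2})}\int_0^1\frac{|1-r^{(\alpha-1)/p}|^p}{(1-r)^{1+\alpha}}\,dr ,$$ where $dw$ is the surface measure on $\mathbb S^{n-1}$ (counting measure on $\{-1,1\}$ if $n=1$). (1) For every domain $\Omega\subset\mathbb R^n$ and every $f\in C_c^\infty(\Omega)$, $$\iint_{\Omega\times\Omega}\frac{|f(x)-f(y)|^p}{|x-y|^{n+\alpha}}\,dx\,dy\;\ge\;\mathcal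 D_{n,p,\alpha}\int_\Omega\frac{|f(x)|^p}{m_\alpha(x)^\alpha}\,dx .$$ (2) The constant is sharp: if $C\in\mathbb R$ and the inequality in (1) holds with $C$ in place of $\mathcal D_{n,p,\alpha}$ for all domains $\Omega$ and all $f\in C_c^\infty(\Omega)$, then $C\le\mathcal D_{n,p,\alpha}$. (3) If $\Omega$ is a convex domain and $d_\Omega(x)$ is the distance from $x$ to $\partial\Omega$ ($=\infty$ if $\partial\Omega=\emptyset$), then for every $f\in C_c^\infty(\Omega)$ $$\iint_{\Omega\times\Omega}\frac{|f(x)-f(y)|^p}{|x-y|^{n+\alpha}}\,dx\,dy\;\ge\;\mathcal D_{n,p,\alpha}\int_\Omega\frac{|f(x)|^p}{d_\Omega(x)^\alpha}\,dx .$$ (4) On every single convex domain $\Omega$ with non-empty boundary the constant is sharp in both inequalities: if $C\in\mathbb R$ and the inequality in (1), or the one in (3), holds on this $\Omega$ for all $f\in C_c^\infty(\Omega)$ with $C$ in place of $\mathcal D_{n,p,\alpha}$, then $C\le\mathcal D_{n,p,\alpha}$. -/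

import Mathlib

open MeasureTheory TopologicalSpace
open scoped ENNReal Distributions

namespace FracHardy

/-- The space `ℝⁿ` with its Euclidean norm. -/
abbrev Space (n : ℕ) : Type := EuclideanSpace ℝ (Fin n)

/-- Surface measure on the unit sphere of `ℝⁿ` (for `n = 1`, counting measure on `{-1, 1}`). -/
noncomputable def surfaceMeasure (n : ℕ) : Measure (Metric.sphere (0 : Space n) 1) :=
  (volume : Measure (Space n)).toSphere

/-- `d_{w,Ω}(x) = min {|t| : x + t w ∉ Ω}`, with value `∞` when the whole line through `x` in
the direction `w` lies in `Ω`. -/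
noncomputable def dirDist {n : ℕ} (Ω : Set (Space n)) (w x : Space n) : ℝ≥0∞ :=
  ⨅ (t : ℝ) (_ : x + t • w ∉ Ω), ENNReal.ofReal |t|

/-- The weight `1 / m_α(x)^α`: the integral of `1 / d_{w,Ω}(x)^α` over all directions `w`, divided
by the integral of `|w_n|^α`. Here `(⊤ : Fin n)` is the last index. -/
noncomputable def mWeight {n : ℕ} [NeZero n] (α : ℝ) (Ω : Set (Space n)) (x : Space n) : ℝ≥0∞ :=
  (∫⁻ w, 1 / dirDist Ω (w : Space n) x ^ α ∂(surfaceMeasure n)) /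
    (∫⁻ w, ENNReal.ofReal (|(w : Space n) (⊤ : Fin n)| ^ α) ∂(surfaceMeasure n))

/-- The weight `1 / d_Ω(x)^α`, where `d_Ω(x)` is the distance of `x` to the boundary of `Ω`
(infinite when the boundary is empty). -/
noncomputable def dWeight {n : ℕ} (α : ℝ) (Ω : Set (Space n)) (x : Space n) : ℝ≥0∞ :=
  1 / Metric.infEDist x (frontier Ω) ^ α

/-- The double integral of `|f x - f y|^p / |x - y|^(n + α)` over `Ω × Ω`. -/
noncomputable def energy {𝕜 : Type*} [RCLike 𝕜] {n : ℕ} (p α : ℝ) (Ω : Set (Space n))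
    (f : Space n → 𝕜) : ℝ≥0∞ :=
  ∫⁻ z in Ω ×ˢ Ω, ‖f z.1 - f z.2‖ₑ ^ p / ‖z.1 - z.2‖ₑ ^ ((n : ℝ) + α)
    ∂((volume : Measure (Space n)).prod volume)

/-- The integral over `Ω` of `|f|^p` against a weight. -/
noncomputable def weightedNorm {𝕜 : Type*} [RCLike 𝕜] {n : ℕ} (p : ℝ) (Ω : Set (Space n))
    (weight : Space n → ℝ≥0∞) (f : Space n → 𝕜) : ℝ≥0∞ :=
  ∫⁻ x in Ω, ‖f x‖ₑ ^ p * weight x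

/-- The constant `D_{n,p,α}`. -/
noncomputable def hardyConst (n : ℕ) (p α : ℝ) : ℝ :=
  2 * Real.pi ^ (((n : ℝ) - 1) / 2) * (Real.Gamma ((1 + α) / 2) / Real.Gamma (((n : ℝ) + α) / 2)) *
    ∫ r in (0 : ℝ)..1, |1 - r ^ ((α - 1) / p)| ^ p / (1 - r) ^ (1 + α)

end FracHardy

/-! ### Polar coordinates and moments of the unit sphere. -/

namespace FracHardy

/-! The inequality reduces to dimension one. In polar coordinates for `y - x`, and by Fubini along
lines, the energy becomes an integral over directions `w` of the `halfEnergy` of `f` on the slices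
of `Ω` parallel to `w` (`energy_eq_polar`, `exists_lintegral_slice`). Each slice is an open subset
of the line, and the distance to its complement is `dirDist`. If every slice satisfies a Hardy
inequality with constant `hardyInt`, integration over `w` gives the numerator of `mWeight`, and the
sphere integral in its denominator is the Gamma factor of `hardyConst`.

In dimension one, an open set is cut into pieces according to the nearest point `a` outside it and
the side on which `a` lies. Each piece is star-shaped about `a`, and interactions between different
pieces are dropped. With `a = 0` on the left, the substitution `t = r s` writes the energy as an
integral over `r` in `(0, 1)` of the `p`-th power of the norm of `u - u(r ·)` in `L^p(s^(-α) ds)`.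
Dilation multiplies the norm by at most `r^((α-1)/p)`, so Minkowski's inequality bounds this
difference below by `(1 - r^((α-1)/p))` times the norm of `u`
(`hardyInt_mul_le_halfEnergy_of_star`).

On a convex set, the supporting hyperplane at the nearest boundary point bounds `dirDist` by `d /
|⟨e, w⟩|`, hence `dWeight ≤ mWeight`, and the inequality with the distance follows.

For sharpness it therefore suffices to treat `dWeight`. Near a boundary point touched by an interior
ball, shrunken copies of any half-space test function fit into the convex set, which passes the
inequality to the half-space (`halfSpace_of_convex`). Products of a function of one coordinate with
a wide transverse cutoff pass it to the half-line (`halfLine_of_halfSpace`). There, `s^((α-1)/p)`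
with a logarithmic cutoff nearly attains equality in Minkowski for all `r` at once
(`le_of_halfLine`). Sharpness over all domains is the case of the half-space. -/

instance {n : ℕ} : IsFiniteMeasure (surfaceMeasure n) := by
  unfold surfaceMeasure; infer_instance

theorem lintegral_polar {n : ℕ} [NeZero n] {F : Space n → ℝ≥0∞} (hF : Measurable F) :
    ∫⁻ x, F x = ∫⁻ w, (∫⁻ t in Set.Ioi (0 : ℝ),
      ENNReal.ofReal (t ^ (n - 1)) * F (t • (w : Space n))) ∂surfaceMeasure n := by
  have hmp := (volume : Measure (Space n)).measurePreserving_homeomorphUnitSphereProd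
  rw [← restrict_compl_singleton (μ := (volume : Measure (Space n))) 0,
    ← lintegral_subtype_comap (measurableSet_singleton _).compl]
  have key : ∀ z : ({0}ᶜ : Set (Space n)), F z =
      (fun y : Metric.sphere (0 : Space n) 1 × Set.Ioi (0 : ℝ) => F ((y.2 : ℝ) • (y.1 : Space n)))
        (homeomorphUnitSphereProd (Space n) z) := by
    intro z
    have h0 : ‖(z : Space n)‖ ≠ 0 := norm_ne_zero_iff.2 z.2
    simp [smul_smul, h0]
  have hmeas : Measurable (fun y : Metric.sphere (0 : Space n) 1 × Set.Ioi (0 : ℝ) =>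
      F ((y.2 : ℝ) • (y.1 : Space n))) := hF.comp (by fun_prop)
  rw [lintegral_congr key, hmp.lintegral_comp hmeas, lintegral_prod _ hmeas.aemeasurable]
  refine lintegral_congr fun w => ?_
  have hw : Measurable fun t : ℝ => F (t • (w : Space n)) := hF.comp (by fun_prop)
  simp only [finrank_euclideanSpace, Fintype.card_fin, Measure.volumeIoiPow]
  refine (lintegral_withDensity_eq_lintegral_mul _ (by fun_prop)
    (hw.comp measurable_subtype_coe)).trans ?_
  exact lintegral_subtype_comap measurableSet_Ioi
    (fun t : ℝ => ENNReal.ofReal (t ^ (n - 1)) * F (t • (w : Space n)))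

theorem lintegral_prod_fin {n : ℕ} {F : Fin n → ℝ → ℝ≥0∞} (hF : ∀ i, Measurable (F i)) :
    ∫⁻ x : Fin n → ℝ, ∏ i, F i (x i) = ∏ i, ∫⁻ t, F i t := by
  induction n with
  | zero => simp [volume_pi]
  | succ n ih =>
    rw [← ((volume_preserving_piFinSuccAbove (fun _ : Fin (n + 1) => ℝ) 0).symm _).lintegral_comp
      (by fun_prop)]
    simp only [Fin.prod_univ_succ, MeasurableEquiv.piFinSuccAbove_symm_apply, Fin.insertNthEquiv,
      Fin.insertNth_zero', Equiv.coe_fn_mk, Fin.cons_zero, Fin.cons_succ]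
    rw [← ih fun i => hF i.succ]
    exact lintegral_prod_mul (μ := (volume : Measure ℝ)) (ν := (volume : Measure (Fin n → ℝ))) (f := F 0) (g := fun y : Fin n → ℝ => ∏ i, F i.succ (y i)) (hF 0).aemeasurable
      (Finset.measurable_fun_prod _ fun i _ => (hF _).comp (measurable_pi_apply i)).aemeasurable

theorem lintegral_prod_space {n : ℕ} {F : Fin n → ℝ → ℝ≥0∞} (hF : ∀ i, Measurable (F i)) :
    ∫⁻ x : Space n, ∏ i, F i (x i) = ∏ i, ∫⁻ t, F i t := by
  rw [← lintegral_prod_fin hF, ← (PiLp.volume_preserving_ofLp (Fin n)).lintegral_comp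
    (f := fun y : Fin n → ℝ => ∏ i, F i (y i)) (Finset.measurable_fun_prod _ fun i _ => (hF _).comp (measurable_pi_apply i))]

theorem exists_orthonormalBasis_apply_eq {n : ℕ} (i : Fin n) {e : Space n} (he : ‖e‖ = 1) :
    ∃ b : OrthonormalBasis (Fin n) ℝ (Space n), b i = e := by
  have h : Orthonormal ℝ (({i} : Set (Fin n)).domRestrict fun _ : Fin n => e) := by
    rw [orthonormal_iff_ite]
    rintro ⟨a, rfl⟩ ⟨b, rfl⟩
    simp [Set.domRestrict, he]
  obtain ⟨b, hb⟩ := h.exists_orthonormalBasis_extension_of_card_eq (by simp)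
  exact ⟨b, hb i rfl⟩

theorem lintegral_comp_repr {n : ℕ} (b : OrthonormalBasis (Fin n) ℝ (Space n))
    (F : Space n → ℝ≥0∞) : ∫⁻ x, F (b.repr x) = ∫⁻ x, F x :=
  b.measurePreserving_repr.lintegral_comp_emb b.repr.toHomeomorph.measurableEmbedding F

theorem lintegral_rpow_mul_exp_neg_sq {q : ℝ} (hq : -1 < q) :
    ∫⁻ t in Set.Ioi (0 : ℝ), ENNReal.ofReal (t ^ q * Real.exp (-t ^ (2 : ℝ))) =
      ENNReal.ofReal (Real.Gamma ((q + 1) / 2) / 2) := by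
  have h := integral_rpow_mul_exp_neg_rpow (p := 2) two_pos hq
  have hG : 0 < Real.Gamma ((q + 1) / 2) := Real.Gamma_pos_of_pos (by linarith)
  rw [← ofReal_integral_eq_lintegral_ofReal, h]
  · congr 1; ring
  · by_contra hn
    rw [integral_undef hn] at h
    linarith
  · filter_upwards [ae_restrict_mem measurableSet_Ioi] with t ht
    have : (0 : ℝ) < t := ht
    positivity

theorem lintegral_eq_two_mul_of_even {F : ℝ → ℝ≥0∞} (hF : ∀ t, F (-t) = F t) :
    ∫⁻ t, F t = 2 * ∫⁻ t in Set.Ioi (0 : ℝ), F t := by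
  rw [← lintegral_add_compl F (measurableSet_Ioi (a := (0 : ℝ))), two_mul, Set.compl_Ioi,
    ← Measure.restrict_congr_set (Iio_ae_eq_Iic (α := ℝ) (μ := volume) (a := 0))]
  congr 1
  rw [← (Measure.measurePreserving_neg (volume : Measure ℝ)).setLIntegral_comp_preimage_emb
    (Homeomorph.neg ℝ).measurableEmbedding F (Set.Iio 0)]
  simp [hF]

theorem lintegral_abs_rpow_mul_exp_neg_sq {q : ℝ} (hq : -1 < q) :
    ∫⁻ t : ℝ, ENNReal.ofReal (|t| ^ q * Real.exp (-t ^ 2)) =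
      ENNReal.ofReal (Real.Gamma ((q + 1) / 2)) := by
  have h : ∫⁻ t in Set.Ioi (0 : ℝ), ENNReal.ofReal (|t| ^ q * Real.exp (-t ^ 2)) =
      ∫⁻ t in Set.Ioi (0 : ℝ), ENNReal.ofReal (t ^ q * Real.exp (-t ^ (2 : ℝ))) :=
    setLIntegral_congr_fun measurableSet_Ioi fun t ht => by
      simp [abs_of_pos (show (0 : ℝ) < t from ht)]
  rw [lintegral_eq_two_mul_of_even (by simp), h, lintegral_rpow_mul_exp_neg_sq hq,
    ← ENNReal.ofReal_ofNat, ← ENNReal.ofReal_mul zero_le_two]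
  congr 1
  ring

theorem lintegral_abs_coord_rpow_mul_exp {n : ℕ} (i : Fin n) {α : ℝ} (hα : -1 < α) :
    ∫⁻ x : Space n, ENNReal.ofReal (|x i| ^ α * Real.exp (-‖x‖ ^ 2)) =
      ENNReal.ofReal (Real.pi ^ (((n : ℝ) - 1) / 2) * Real.Gamma ((1 + α) / 2)) := by
  have h : ∀ x : Space n, ENNReal.ofReal (|x i| ^ α * Real.exp (-‖x‖ ^ 2)) =
      ∏ j, (fun (j : Fin n) (t : ℝ) => ENNReal.ofReal
        (|t| ^ (if j = i then α else 0) * Real.exp (-t ^ 2))) j (x j) := by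
    intro x
    rw [← ENNReal.ofReal_prod_of_nonneg fun j _ => by positivity, Finset.prod_mul_distrib,
      ← Real.exp_sum, EuclideanSpace.real_norm_sq_eq, Finset.sum_neg_distrib]
    congr 2
    rw [Finset.prod_eq_single i] <;> simp +contextual
  rw [lintegral_congr h, lintegral_prod_space (F := fun (j : Fin n) (t : ℝ) => ENNReal.ofReal
    (|t| ^ (if j = i then α else 0) * Real.exp (-t ^ 2))) fun j => by fun_prop]
  have h2 : ∀ j : Fin n, ∫⁻ t : ℝ, ENNReal.ofReal
        (|t| ^ (if j = i then α else 0) * Real.exp (-t ^ 2)) =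
      ENNReal.ofReal (Real.Gamma (((if j = i then α else 0) + 1) / 2)) :=
    fun j => lintegral_abs_rpow_mul_exp_neg_sq (by split_ifs <;> linarith)
  simp only [h2]
  rw [← ENNReal.ofReal_prod_of_nonneg fun j _ => Real.Gamma_nonneg_of_nonneg (by split_ifs <;> linarith),
    ← Finset.mul_prod_erase _ _ (Finset.mem_univ i), Finset.prod_congr rfl (g := fun _ => √Real.pi)
      fun j hj => by rw [if_neg (Finset.ne_of_mem_erase hj), zero_add, Real.Gamma_one_half_eq]]
  have hn : 1 ≤ n := i.pos
  rw [Finset.prod_const, Finset.card_erase_of_mem (Finset.mem_univ i), if_pos rfl, Finset.card_univ,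
    Fintype.card_fin, Real.sqrt_eq_rpow, ← Real.rpow_mul_natCast Real.pi_nonneg, Nat.cast_sub hn,
    mul_comm, add_comm α]
  congr 3
  push_cast
  ring

/-- The integral of `|⟨e, x⟩|^α exp(-‖x‖²)` over the whole space is computed twice: in an
orthonormal basis containing `e` it is a product of one-dimensional Gaussian moments, and in polar
coordinates it is the sphere integral times a radial Gamma integral. The value does not depend on
`e`, and this serves as rotation invariance later on. -/
theorem lintegral_sphere_abs_inner_rpow {n : ℕ} [NeZero n] {e : Space n} (he : ‖e‖ = 1) {α : ℝ}
    (hα : -1 < α) :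
    ∫⁻ w, ENNReal.ofReal (|inner ℝ e (w : Space n)| ^ α) ∂surfaceMeasure n =
      ENNReal.ofReal (2 * Real.pi ^ (((n : ℝ) - 1) / 2) *
        (Real.Gamma ((1 + α) / 2) / Real.Gamma (((n : ℝ) + α) / 2))) := by
  have hn : (1 : ℝ) ≤ n := by exact_mod_cast NeZero.one_le
  have hG : 0 < Real.Gamma (((n : ℝ) + α) / 2) := Real.Gamma_pos_of_pos (by linarith)
  obtain ⟨b, hb⟩ := exists_orthonormalBasis_apply_eq (⊤ : Fin n) he
  have h1 := lintegral_abs_coord_rpow_mul_exp (⊤ : Fin n) hα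
  rw [← lintegral_comp_repr b] at h1
  simp only [b.repr_apply_apply, hb, b.repr.norm_map] at h1
  rw [lintegral_polar (by fun_prop)] at h1
  have h2 : ∀ w : Metric.sphere (0 : Space n) 1, (∫⁻ t in Set.Ioi (0 : ℝ),
      ENNReal.ofReal (t ^ (n - 1)) * ENNReal.ofReal (|inner ℝ e (t • (w : Space n))| ^ α *
        Real.exp (-‖t • (w : Space n)‖ ^ 2))) =
      ENNReal.ofReal (|inner ℝ e (w : Space n)| ^ α) *
        ENNReal.ofReal (Real.Gamma (((n : ℝ) + α) / 2) / 2) := by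
    intro w
    rw [show (n : ℝ) + α = (n - 1 + α) + 1 by ring,
      ← lintegral_rpow_mul_exp_neg_sq (by linarith), ← lintegral_const_mul _ (by fun_prop)]
    refine setLIntegral_congr_fun measurableSet_Ioi fun t ht => ?_
    have ht : (0 : ℝ) < t := ht
    have hw : ‖(w : Space n)‖ = 1 := by simp
    rw [← ENNReal.ofReal_mul (by positivity), ← ENNReal.ofReal_mul (by positivity),
      inner_smul_right, abs_mul, Real.mul_rpow (abs_nonneg _) (abs_nonneg _), norm_smul, hw,
      Real.rpow_add ht, abs_of_pos ht, Real.norm_of_nonneg ht.le, mul_one,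
      ← Real.rpow_natCast t (n - 1), Nat.cast_sub NeZero.one_le]
    congr 1
    norm_num
    ring
  rw [lintegral_congr h2, lintegral_mul_const _ (by fun_prop)] at h1
  refine (ENNReal.mul_left_inj (c := ENNReal.ofReal (Real.Gamma (((n : ℝ) + α) / 2) / 2))
    (by simpa using hG) ENNReal.ofReal_ne_top).1 (h1.trans ?_)
  rw [← ENNReal.ofReal_mul' (by positivity)]
  congr 1
  field_simp

end FracHardy

/-! ### The half-line inequality on star-shaped sets. -/

namespace FracHardy

/-- The one-dimensional energy of `u` on `U`, each unordered pair of points counted once. -/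
noncomputable def halfEnergy {𝕜 : Type*} [RCLike 𝕜] (p α : ℝ) (U : Set ℝ) (u : ℝ → 𝕜) : ℝ≥0∞ :=
  ∫⁻ z in {z : ℝ × ℝ | z.1 ∈ U ∧ z.2 ∈ U ∧ z.2 < z.1},
    ‖u z.1 - u z.2‖ₑ ^ p * ENNReal.ofReal ((z.1 - z.2) ^ (-(1 + α)))

/-- The integral appearing in the sharp constant. -/
noncomputable def hardyInt (p α : ℝ) : ℝ≥0∞ :=
  ∫⁻ r in Set.Ioo (0 : ℝ) 1,
    ENNReal.ofReal ((1 - r) ^ (-(1 + α))) * ENNReal.ofReal (1 - r ^ ((α - 1) / p)) ^ p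

theorem lintegral_comp_mul_left {c : ℝ} (hc : 0 < c) (G : ℝ → ℝ≥0∞) :
    ENNReal.ofReal c * ∫⁻ t, G (c * t) = ∫⁻ t, G t := by
  have h := (Homeomorph.mulLeft₀ c hc.ne').measurableEmbedding.lintegral_map (μ := volume) G
  have h' : ∫⁻ t, G (c * t) = ENNReal.ofReal |c⁻¹| * ∫⁻ t, G t := by
    rw [show ⇑(Homeomorph.mulLeft₀ c hc.ne') = (c * ·) from rfl,
      Real.map_volume_mul_left hc.ne', lintegral_smul_measure] at h
    exact h.symm
  rw [h', ← mul_assoc, ← ENNReal.ofReal_mul hc.le, abs_of_pos (inv_pos.2 hc),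
    mul_inv_cancel₀ hc.ne', ENNReal.ofReal_one, one_mul]

theorem setLIntegral_Ioi_comp_mul_left {c : ℝ} (hc : 0 < c) (G : ℝ → ℝ≥0∞) :
    ENNReal.ofReal c * ∫⁻ t in Set.Ioi (0 : ℝ), G (c * t) = ∫⁻ t in Set.Ioi (0 : ℝ), G t := by
  rw [← lintegral_indicator measurableSet_Ioi, ← lintegral_indicator measurableSet_Ioi,
    ← lintegral_comp_mul_left hc ((Set.Ioi 0).indicator G)]
  congr 1
  refine lintegral_congr fun t => ?_
  simp [Set.indicator, hc]

theorem measurableSet_ordered_pairs {U : Set ℝ} (hU : MeasurableSet U) :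
    MeasurableSet {z : ℝ × ℝ | z.1 ∈ U ∧ z.2 ∈ U ∧ z.2 < z.1} :=
  (measurable_fst hU).inter ((measurable_snd hU).inter (measurableSet_lt measurable_snd measurable_fst))

variable {𝕜 : Type*} [RCLike 𝕜] {p α : ℝ}

/-- Substituting `t = r s` at fixed `s` factors the kernel into powers of `s` and `1 - r`, and `dt =
s dr` turns `s^(-(1+α))` into `s^(-α)`. Star-shapedness about `0` makes every `r` in `(0, 1)`
admissible. -/
theorem halfEnergy_eq_dilation {U : Set ℝ} (hU : MeasurableSet U) (hU0 : U ⊆ Set.Ioi 0)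
    (hstar : ∀ s ∈ U, ∀ r ∈ Set.Ioo (0 : ℝ) 1, r * s ∈ U) {u : ℝ → 𝕜} (hu : Measurable u) :
    halfEnergy p α U u = ∫⁻ r in Set.Ioo (0 : ℝ) 1, ENNReal.ofReal ((1 - r) ^ (-(1 + α))) *
      ∫⁻ s in U, ENNReal.ofReal (s ^ (-α)) * ‖u s - u (r * s)‖ₑ ^ p := by
  have hD := measurableSet_ordered_pairs hU
  set D := {z : ℝ × ℝ | z.1 ∈ U ∧ z.2 ∈ U ∧ z.2 < z.1} with hDdef
  set F : ℝ × ℝ → ℝ≥0∞ := fun z => ‖u z.1 - u z.2‖ₑ ^ p *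
    ENNReal.ofReal ((z.1 - z.2) ^ (-(1 + α))) with hFdef
  have hF : Measurable F := by fun_prop
  have h1 : halfEnergy p α U u = ∫⁻ s, ∫⁻ t, D.indicator F (s, t) := by
    rw [halfEnergy, ← lintegral_indicator hD]
    exact lintegral_prod _ (hF.indicator hD).aemeasurable
  have h2 : ∀ s, ∫⁻ t, D.indicator F (s, t) = U.indicator (fun s => ∫⁻ r in Set.Ioo (0 : ℝ) 1,
      ENNReal.ofReal ((1 - r) ^ (-(1 + α))) *
        (ENNReal.ofReal (s ^ (-α)) * ‖u s - u (r * s)‖ₑ ^ p)) s := by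
    intro s
    by_cases hs : s ∈ U
    · have hs0 : 0 < s := hU0 hs
      rw [Set.indicator_of_mem hs, ← lintegral_comp_mul_left hs0,
        ← lintegral_const_mul' _ _ ENNReal.ofReal_ne_top, ← lintegral_indicator measurableSet_Ioo]
      refine lintegral_congr fun r => ?_
      by_cases hr : r ∈ Set.Ioo (0 : ℝ) 1
      · have hmem : (s, s * r) ∈ D :=
          ⟨hs, by rw [mul_comm]; exact hstar s hs r hr, by nlinarith [hr.2]⟩
        have h1r : 0 < 1 - r := by linarith [hr.2]
        rw [Set.indicator_of_mem hr, Set.indicator_of_mem hmem]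
        simp only [hFdef]
        rw [show s - s * r = s * (1 - r) by ring, Real.mul_rpow hs0.le h1r.le,
          ENNReal.ofReal_mul (by positivity), show -α = 1 + -(1 + α) by ring, Real.rpow_add hs0,
          Real.rpow_one, ENNReal.ofReal_mul hs0.le, mul_comm s r]
        ring
      · rw [Set.indicator_of_notMem hr, Set.indicator_of_notMem, mul_zero]
        rintro ⟨-, h2, h3⟩
        have h2' : 0 < s * r := hU0 h2
        exact hr ⟨pos_of_mul_pos_right h2' hs0.le, by
          have h3 : s * r < s := h3
          nlinarith⟩
    · rw [Set.indicator_of_notMem hs]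
      simp [hDdef, Set.indicator, hs]
  rw [h1, lintegral_congr h2, lintegral_indicator hU, lintegral_lintegral_swap (by fun_prop)]
  exact lintegral_congr fun r => lintegral_const_mul' _ _ ENNReal.ofReal_ne_top

/-- For each dilation factor `r` this is the reverse triangle inequality in `L^p(s^(-α) ds)`,
applied to `u` and its dilate. The exponent `(α-1)/p` is the scaling exponent of that norm. -/
theorem hardyInt_mul_le_halfEnergy_of_star (hp : 1 < p) {U : Set ℝ}
    (hα : 1 < α) (hU : MeasurableSet U) (hU0 : U ⊆ Set.Ioi 0)
    (hstar : ∀ s ∈ U, ∀ r ∈ Set.Ioo (0 : ℝ) 1, r * s ∈ U) {u : ℝ → 𝕜} (hu : Measurable u)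
    (hN : ∫⁻ s in U, ENNReal.ofReal (s ^ (-α)) * ‖u s‖ₑ ^ p ≠ ∞) :
    hardyInt p α * ∫⁻ s in U, ENNReal.ofReal (s ^ (-α)) * ‖u s‖ₑ ^ p ≤ halfEnergy p α U u := by
  have hp0 : 0 < p := by linarith
  set N := ∫⁻ s in U, ENNReal.ofReal (s ^ (-α)) * ‖u s‖ₑ ^ p with hNdef
  rw [halfEnergy_eq_dilation hU hU0 hstar hu, hardyInt, ← lintegral_mul_const' _ _ hN]
  refine setLIntegral_mono' measurableSet_Ioo fun r hr => ?_
  rw [mul_assoc]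
  gcongr
  set β := (α - 1) / p with hβ
  have hβ0 : 0 < β := div_pos (by linarith) hp0
  set μ := (volume.restrict U).withDensity (fun s => ENNReal.ofReal (s ^ (-α))) with hμ
  have hμi : ∀ f : ℝ → ℝ≥0∞, Measurable f →
      ∫⁻ s, f s ∂μ = ∫⁻ s in U, ENNReal.ofReal (s ^ (-α)) * f s := fun f hf =>
    lintegral_withDensity_eq_lintegral_mul _ (by fun_prop) hf
  -- After the change of variables the domain becomes the dilated set, which star-shapedness places
  -- inside `U`. This is the only loss here.
  have hY : ∫⁻ s, ‖u (r * s)‖ₑ ^ p ∂μ ≤ ENNReal.ofReal (r ^ (α - 1)) * N := by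
    rw [hμi _ (by fun_prop), hNdef, ← lintegral_indicator hU, ← lintegral_indicator hU,
      ← lintegral_comp_mul_left hr.1
        (U.indicator fun s => ENNReal.ofReal (s ^ (-α)) * ‖u s‖ₑ ^ p), ← mul_assoc,
      ← ENNReal.ofReal_mul (Real.rpow_nonneg hr.1.le _),
      ← lintegral_const_mul' _ _ ENNReal.ofReal_ne_top]
    refine lintegral_mono fun s => ?_
    by_cases hs : s ∈ U
    · have hs0 : 0 < s := hU0 hs
      have hr0 := hr.1
      rw [Set.indicator_of_mem hs, Set.indicator_of_mem (hstar s hs r hr), ← mul_assoc,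
        ← ENNReal.ofReal_mul (by positivity), Real.mul_rpow hr.1.le hs0.le]
      apply le_of_eq
      congr 2
      rw [Real.rpow_neg hr0.le, Real.rpow_sub_one hr0.ne']
      have := (Real.rpow_pos_of_pos hr0 α).ne'
      field_simp
    · simp [hs]
  have hMink := ENNReal.lintegral_Lp_add_le (μ := μ) (f := fun s => ‖u s - u (r * s)‖ₑ)
    (g := fun s => ‖u (r * s)‖ₑ) (by fun_prop) (by fun_prop) hp.le
  have h1 : N ^ (1 / p) ≤ (∫⁻ s, ‖u s - u (r * s)‖ₑ ^ p ∂μ) ^ (1 / p) +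
      ENNReal.ofReal (r ^ β) * N ^ (1 / p) := by
    calc N ^ (1 / p) = (∫⁻ s, ‖u s‖ₑ ^ p ∂μ) ^ (1 / p) := by rw [hμi _ (by fun_prop)]
      _ ≤ (∫⁻ s, ((fun s => ‖u s - u (r * s)‖ₑ) + (fun s => ‖u (r * s)‖ₑ)) s ^ p ∂μ) ^ (1 / p) := by
        gcongr with s
        simpa using enorm_add_le (u s - u (r * s)) (u (r * s))
      _ ≤ _ := hMink
      _ ≤ _ := by
        gcongr
        refine (ENNReal.rpow_le_rpow hY (by positivity)).trans_eq ?_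
        rw [ENNReal.mul_rpow_of_nonneg _ _ (by positivity),
          ENNReal.ofReal_rpow_of_pos (Real.rpow_pos_of_pos hr.1 _), ← Real.rpow_mul hr.1.le]
        congr 3
        rw [hβ]; ring
  have hrβ : r ^ β ≤ 1 := Real.rpow_le_one hr.1.le hr.2.le hβ0.le
  have h2 : ENNReal.ofReal (1 - r ^ β) * N ^ (1 / p) ≤
      (∫⁻ s, ‖u s - u (r * s)‖ₑ ^ p ∂μ) ^ (1 / p) := by
    -- Finiteness of `N` is what permits cancelling the dilated term in `ℝ≥0∞`.
    have hfin : ENNReal.ofReal (r ^ β) * N ^ (1 / p) ≠ ∞ :=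
      ENNReal.mul_ne_top ENNReal.ofReal_ne_top (ENNReal.rpow_ne_top_of_nonneg (by positivity) hN)
    refine (ENNReal.add_le_add_iff_right hfin).1 (le_trans (le_of_eq ?_) h1)
    rw [← add_mul, ← ENNReal.ofReal_add (by linarith) (Real.rpow_nonneg hr.1.le _)]
    simp
  have h3 := ENNReal.rpow_le_rpow h2 hp0.le
  rwa [ENNReal.mul_rpow_of_nonneg _ _ hp0.le, ← ENNReal.rpow_mul, ← ENNReal.rpow_mul,
    one_div_mul_cancel hp0.ne', ENNReal.rpow_one, ENNReal.rpow_one, hμi _ (by fun_prop)] at h3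

/-- Change of variables by an isometry of the line. -/
theorem halfEnergy_add_left (a : ℝ) {U : Set ℝ} (u : ℝ → 𝕜) :
    halfEnergy p α ((a + ·) ⁻¹' U) (fun s => u (a + s)) = halfEnergy p α U u := by
  have hmp : MeasurePreserving (fun z : ℝ × ℝ => (a + z.1, a + z.2)) :=
    (measurePreserving_add_left volume a).prod (measurePreserving_add_left volume a)
  have he : MeasurableEmbedding (fun z : ℝ × ℝ => (a + z.1, a + z.2)) :=
    ((Homeomorph.addLeft a).prodCongr (Homeomorph.addLeft a)).measurableEmbedding
  rw [halfEnergy, halfEnergy, ← hmp.setLIntegral_comp_preimage_emb he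
    (fun z => ‖u z.1 - u z.2‖ₑ ^ p * ENNReal.ofReal ((z.1 - z.2) ^ (-(1 + α))))]
  simp

theorem halfEnergy_sub_left (a : ℝ) {U : Set ℝ} (u : ℝ → 𝕜) :
    halfEnergy p α ((a - ·) ⁻¹' U) (fun s => u (a - s)) = halfEnergy p α U u := by
  -- Reflection reverses the order, so the two coordinates are swapped to preserve the region `z.2 <
  -- z.1`.
  have hmp : MeasurePreserving (fun z : ℝ × ℝ => (a - z.2, a - z.1)) :=
    ((Measure.measurePreserving_sub_left volume a).prod
      (Measure.measurePreserving_sub_left volume a)).comp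
      Measure.measurePreserving_swap
  have he : MeasurableEmbedding (fun z : ℝ × ℝ => (a - z.2, a - z.1)) :=
    ((Homeomorph.prodComm ℝ ℝ).trans
      ((Homeomorph.subLeft a).prodCongr (Homeomorph.subLeft a))).measurableEmbedding
  rw [halfEnergy, halfEnergy, ← hmp.setLIntegral_comp_preimage_emb he
    (fun z => ‖u z.1 - u z.2‖ₑ ^ p * ENNReal.ofReal ((z.1 - z.2) ^ (-(1 + α))))]
  have : {z : ℝ × ℝ | z.1 ∈ (a - ·) ⁻¹' U ∧ z.2 ∈ (a - ·) ⁻¹' U ∧ z.2 < z.1} =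
      (fun z : ℝ × ℝ => (a - z.2, a - z.1)) ⁻¹' {z | z.1 ∈ U ∧ z.2 ∈ U ∧ z.2 < z.1} := by
    ext z; simp; tauto
  rw [this]
  refine lintegral_congr fun z => ?_
  rw [← enorm_neg]
  simp

end FracHardy

/-! ### The one-dimensional inequality on arbitrary open sets. -/

namespace FracHardy

variable {𝕜 : Type*} [RCLike 𝕜] {p α : ℝ}

/-- The singularity `a` has positive distance from the compact support, so the integrand is bounded
there. This supplies the finiteness needed for the cancellation in Minkowski's inequality. -/
theorem lintegral_abs_sub_rpow_mul_ne_top (hp : 0 < p) {u : ℝ → 𝕜} (hu : Continuous u)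
    (hc : HasCompactSupport u) {a : ℝ} (ha : a ∉ tsupport u) (W : Set ℝ) :
    ∫⁻ s in W, ENNReal.ofReal (|s - a| ^ (-α)) * ‖u s‖ₑ ^ p ≠ ∞ := by
  have hcont : ContinuousOn (fun s => |s - a| ^ (-α) * ‖u s‖ ^ p) (tsupport u) := by
    refine ContinuousOn.mul (ContinuousOn.rpow_const (by fun_prop) fun s hs => Or.inl ?_)
      (ContinuousOn.rpow_const (by fun_prop) fun s _ => Or.inr hp.le)
    rw [abs_ne_zero, sub_ne_zero]
    rintro rfl
    exact ha hs
  obtain ⟨C, hC⟩ := hc.isCompact.exists_bound_of_continuousOn hcont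
  refine ne_top_of_le_ne_top ?_ (setLIntegral_le_lintegral W _)
  refine ne_top_of_le_ne_top (b := ∫⁻ s in tsupport u, ENNReal.ofReal C) ?_ ?_
  · rw [setLIntegral_const]
    exact ENNReal.mul_ne_top ENNReal.ofReal_ne_top hc.isCompact.measure_lt_top.ne
  · rw [← lintegral_indicator (isClosed_tsupport u).measurableSet]
    refine lintegral_mono fun s => ?_
    by_cases hs : s ∈ tsupport u
    · rw [Set.indicator_of_mem hs, ← ofReal_norm,
        ENNReal.ofReal_rpow_of_nonneg (norm_nonneg _) hp.le, ← ENNReal.ofReal_mul (by positivity)]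
      exact ENNReal.ofReal_le_ofReal ((le_abs_self _).trans (hC s hs))
    · simp [image_eq_zero_of_notMem_tsupport hs, hp]

theorem hardyInt_mul_le_halfEnergy_of_star_right (hp : 1 < p) {W : Set ℝ}
    (hα : 1 < α) (hW : MeasurableSet W) {a : ℝ} (hWa : W ⊆ Set.Ioi a)
    (hstar : ∀ s ∈ W, ∀ r ∈ Set.Ioo (0 : ℝ) 1, a + r * (s - a) ∈ W) {u : ℝ → 𝕜} (hu : Measurable u)
    (hN : ∫⁻ s in W, ENNReal.ofReal (|s - a| ^ (-α)) * ‖u s‖ₑ ^ p ≠ ∞) :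
    hardyInt p α * ∫⁻ s in W, ENNReal.ofReal (|s - a| ^ (-α)) * ‖u s‖ₑ ^ p
      ≤ halfEnergy p α W u := by
  have hW' : MeasurableSet ((a + ·) ⁻¹' W) := (measurable_const_add a) hW
  have h0 : (a + ·) ⁻¹' W ⊆ Set.Ioi 0 := fun s hs => by simpa using hWa hs
  have h1 : ∫⁻ s in (a + ·) ⁻¹' W, ENNReal.ofReal (s ^ (-α)) * ‖u (a + s)‖ₑ ^ p =
      ∫⁻ s in W, ENNReal.ofReal (|s - a| ^ (-α)) * ‖u s‖ₑ ^ p := by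
    rw [← (measurePreserving_add_left volume a).setLIntegral_comp_preimage_emb
      (Homeomorph.addLeft a).measurableEmbedding
      (fun s => ENNReal.ofReal (|s - a| ^ (-α)) * ‖u s‖ₑ ^ p)]
    refine setLIntegral_congr_fun hW' fun s hs => ?_
    simp only [add_sub_cancel_left, abs_of_pos (show 0 < s from h0 hs)]
  rw [← halfEnergy_add_left a, ← h1]
  refine hardyInt_mul_le_halfEnergy_of_star hp hα hW' h0 (fun s hs r hr => ?_)
    (u := fun s => u (a + s)) (by fun_prop) (by rwa [h1])
  simpa using hstar _ hs r hr

theorem hardyInt_mul_le_halfEnergy_of_star_left (hp : 1 < p) {W : Set ℝ}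
    (hα : 1 < α) (hW : MeasurableSet W) {a : ℝ} (hWa : W ⊆ Set.Iio a)
    (hstar : ∀ s ∈ W, ∀ r ∈ Set.Ioo (0 : ℝ) 1, a + r * (s - a) ∈ W) {u : ℝ → 𝕜} (hu : Measurable u)
    (hN : ∫⁻ s in W, ENNReal.ofReal (|s - a| ^ (-α)) * ‖u s‖ₑ ^ p ≠ ∞) :
    hardyInt p α * ∫⁻ s in W, ENNReal.ofReal (|s - a| ^ (-α)) * ‖u s‖ₑ ^ p
      ≤ halfEnergy p α W u := by
  have hW' : MeasurableSet ((a - ·) ⁻¹' W) := (measurable_const.sub measurable_id) hW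
  have h0 : (a - ·) ⁻¹' W ⊆ Set.Ioi 0 := fun s hs => by simpa using hWa hs
  have h1 : ∫⁻ s in (a - ·) ⁻¹' W, ENNReal.ofReal (s ^ (-α)) * ‖u (a - s)‖ₑ ^ p =
      ∫⁻ s in W, ENNReal.ofReal (|s - a| ^ (-α)) * ‖u s‖ₑ ^ p := by
    rw [← (Measure.measurePreserving_sub_left volume a).setLIntegral_comp_preimage_emb
      (Homeomorph.subLeft a).measurableEmbedding
      (fun s => ENNReal.ofReal (|s - a| ^ (-α)) * ‖u s‖ₑ ^ p)]
    refine setLIntegral_congr_fun hW' fun s hs => ?_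
    simp only [sub_sub_cancel_left, abs_neg, abs_of_pos (show 0 < s from h0 hs)]
  rw [← halfEnergy_sub_left a, ← h1]
  refine hardyInt_mul_le_halfEnergy_of_star hp hα hW' h0 (fun s hs r hr => ?_)
    (u := fun s => u (a - s)) (by fun_prop) (by rwa [h1])
  have := hstar _ hs r hr
  simp only [Set.mem_preimage]
  convert this using 1
  ring

/-- Pairs with both points in one piece form disjoint regions; pairs joining different pieces are
discarded. -/
theorem tsum_halfEnergy_le {ι : Type*} [Countable ι] {W : ι → Set ℝ} {J : Set ℝ}
    (hW : ∀ i, MeasurableSet (W i)) (hd : Pairwise (Function.onFun Disjoint W)) (hJ : ∀ i, W i ⊆ J)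
    (u : ℝ → 𝕜) : ∑' i, halfEnergy p α (W i) u ≤ halfEnergy p α J u := by
  unfold halfEnergy
  rw [← lintegral_iUnion (fun i => measurableSet_ordered_pairs (hW i))]
  · refine lintegral_mono_set (Set.iUnion_subset fun i z hz => ⟨hJ i hz.1, hJ i hz.2.1, hz.2.2⟩)
  · intro i j hij
    rw [Function.onFun, Set.disjoint_left]
    exact fun z hz hz' => Set.disjoint_left.1 (hd hij) hz.1 hz'.1

/-- Points of `J` whose nearest point outside `J` is `i.2`, lying to the left (`i.1 = true`) or
only to the right (`i.1 = false`). -/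
def nearSet (J : Set ℝ) (i : Bool × ℝ) : Set ℝ :=
  match i with
  | (true, a) => {s | a < s ∧ Metric.infDist s Jᶜ = s - a}
  | (false, a) => {s | s < a ∧ Metric.infDist s Jᶜ = a - s ∧ 2 * s - a ∈ J}

theorem infDist_eq_of_mem_nearSet {J : Set ℝ} {i : Bool × ℝ} {s : ℝ} (hs : s ∈ nearSet J i) :
    0 < |s - i.2| ∧ Metric.infDist s Jᶜ = |s - i.2| := by
  obtain ⟨_ | _, a⟩ := i
  · simp only [nearSet, Set.mem_ofPred_eq] at hs
    rw [abs_of_neg (by linarith)]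
    exact ⟨by linarith, by linarith⟩
  · simp only [nearSet, Set.mem_ofPred_eq] at hs
    rw [abs_of_pos (by linarith)]
    exact ⟨by linarith, by linarith⟩

theorem measurableSet_nearSet {J : Set ℝ} (hJ : IsOpen J) (i : Bool × ℝ) :
    MeasurableSet (nearSet J i) := by
  obtain ⟨_ | _, a⟩ := i
  · exact (measurableSet_lt measurable_id measurable_const).inter
      ((measurableSet_eq_fun (by fun_prop) (by fun_prop)).inter
        (hJ.preimage (f := fun s : ℝ => 2 * s - a) (by fun_prop)).measurableSet)
  · exact (measurableSet_lt measurable_const measurable_id).inter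
      (measurableSet_eq_fun (by fun_prop) (by fun_prop))

theorem mem_of_infDist_compl_pos {J : Set ℝ} {s : ℝ} (h : 0 < Metric.infDist s Jᶜ) : s ∈ J := by
  by_contra hs
  rw [Metric.infDist_zero_of_mem hs] at h
  exact h.false

theorem nearSet_subset (J : Set ℝ) (i : Bool × ℝ) : nearSet J i ⊆ J := fun s hs =>
  mem_of_infDist_compl_pos (by
    have := infDist_eq_of_mem_nearSet hs
    rw [this.2]; exact this.1)

theorem exists_mem_nearSet {J : Set ℝ} (hJ : IsOpen J) (hne : Jᶜ.Nonempty) {s : ℝ} (hs : s ∈ J) :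
    ∃ i : Bool × ℝ, i.2 ∉ J ∧ s ∈ nearSet J i := by
  obtain ⟨a, ha, hd⟩ := hJ.isClosed_compl.exists_infDist_eq_dist hne s
  have hsa : s ≠ a := by rintro rfl; exact ha hs
  rw [Real.dist_eq] at hd
  rcases lt_or_gt_of_ne hsa with h | h
  · rw [abs_of_neg (by linarith)] at hd
    by_cases h2 : 2 * s - a ∈ J
    · exact ⟨(false, a), ha, h, by linarith, h2⟩
    -- Here `s` is the midpoint of two nearest points outside `J`. The tie is assigned to the left
    -- one, which keeps the pieces disjoint.
    · exact ⟨(true, 2 * s - a), h2, by linarith, by linarith⟩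
  · rw [abs_of_pos (by linarith)] at hd
    exact ⟨(true, a), ha, h, hd⟩

theorem disjoint_nearSet {J : Set ℝ} {i j : Bool × ℝ} (hi : i.2 ∉ J) (hj : j.2 ∉ J) (hij : i ≠ j) :
    Disjoint (nearSet J i) (nearSet J j) := by
  rw [Set.disjoint_left]
  intro s hsi hsj
  obtain ⟨_ | _, a⟩ := i <;> obtain ⟨_ | _, b⟩ := j <;>
    simp only [nearSet, Set.mem_ofPred_eq] at hsi hsj
  · exact hij (by rw [show a = b by linarith])
  · exact hj (by convert hsi.2.2 using 1; dsimp only; linarith)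
  · exact hi (by convert hsj.2.2 using 1; dsimp only; linarith)
  · exact hij (by rw [show a = b by linarith])

/-- The distance function is 1-Lipschitz, so on moving from `s` towards its nearest point the
distance falls by exactly the length travelled and that point stays nearest. -/
theorem nearSet_star {J : Set ℝ} {i : Bool × ℝ} (hi : i.2 ∉ J) {s r : ℝ}
    (hs : s ∈ nearSet J i) (hr : r ∈ Set.Ioo (0 : ℝ) 1) : i.2 + r * (s - i.2) ∈ nearSet J i := by
  have hd : ∀ t, |t - i.2| ≤ |s - i.2| → |s - t| = |s - i.2| - |t - i.2| →
      Metric.infDist t Jᶜ = |t - i.2| := by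
    intro t _ h2
    apply le_antisymm
    · simpa [Real.dist_eq] using Metric.infDist_le_dist_of_mem (x := t) hi
    · have := Metric.infDist_le_infDist_add_dist (s := Jᶜ) (x := s) (y := t)
      rw [(infDist_eq_of_mem_nearSet hs).2, Real.dist_eq] at this
      linarith
  obtain ⟨hr0, hr1⟩ := hr
  have key := hd (i.2 + r * (s - i.2)) (by
      rw [add_sub_cancel_left, abs_mul, abs_of_pos hr0]
      nlinarith [abs_nonneg (s - i.2)]) (by
      rw [add_sub_cancel_left, show s - (i.2 + r * (s - i.2)) = (1 - r) * (s - i.2) by ring, abs_mul,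
        abs_mul, abs_of_pos hr0, abs_of_pos (by linarith : 0 < 1 - r)]
      ring)
  rw [add_sub_cancel_left] at key
  -- For right-hand pieces the tie-breaking condition must survive too: the mirror image of the
  -- moved point lies in the ball about `s` that avoids the complement.
  have hball : ∀ t, |t - s| < |s - i.2| → t ∈ J := by
    intro t ht
    apply mem_of_infDist_compl_pos
    have := Metric.infDist_le_infDist_add_dist (s := Jᶜ) (x := s) (y := t)
    rw [(infDist_eq_of_mem_nearSet hs).2, dist_comm, Real.dist_eq] at this
    linarith
  obtain ⟨_ | _, a⟩ := i <;> simp only [nearSet, Set.mem_ofPred_eq] at hs hball key ⊢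
  · rw [abs_of_neg (mul_neg_of_pos_of_neg hr0 (by linarith))] at key
    refine ⟨by nlinarith, by rw [key]; ring, hball _ ?_⟩
    rw [abs_of_neg (a := s - a) (by linarith), abs_lt]
    constructor <;> nlinarith
  · rw [abs_of_pos (mul_pos hr0 (by linarith))] at key
    exact ⟨by nlinarith, by rw [key]; ring⟩

/-- A piece contains the open segment from its nearest point to any of its points. Disjoint sets
with interior are countably many, so the pieces can be summed. -/
theorem interior_nearSet_nonempty {J : Set ℝ} {i : Bool × ℝ} (hi : i.2 ∉ J)
    (h : (nearSet J i).Nonempty) : (interior (nearSet J i)).Nonempty := by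
  obtain ⟨s, hs⟩ := h
  have hne : s - i.2 ≠ 0 := abs_pos.1 (infDist_eq_of_mem_nearSet hs).1
  let e : ℝ ≃ₜ ℝ := (Homeomorph.mulRight₀ (s - i.2) hne).trans (Homeomorph.addLeft i.2)
  refine ⟨e (1 / 2), interior_mono (s := e '' Set.Ioo 0 1) ?_ ?_⟩
  · rintro _ ⟨r, hr, rfl⟩
    exact nearSet_star hi hs hr
  · rw [(e.isOpenMap _ isOpen_Ioo).interior_eq]
    exact ⟨1 / 2, by norm_num, rfl⟩

/-- The sharp one-dimensional fractional Hardy inequality on an open set of the line. -/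
theorem hardyInt_mul_le_halfEnergy (hp : 1 < p) (hα : 1 < α) {J : Set ℝ} (hJ : IsOpen J)
    {u : ℝ → 𝕜} (hu : Continuous u) (hc : HasCompactSupport u) (hs : tsupport u ⊆ J) :
    hardyInt p α * ∫⁻ s in J, ‖u s‖ₑ ^ p * (1 / Metric.infEDist s Jᶜ ^ α) ≤
      halfEnergy p α J u := by
  rcases Jᶜ.eq_empty_or_nonempty with he | hne
  · simp [he, show 0 < α by linarith]
  let ι := {i : Bool × ℝ // i.2 ∉ J ∧ (nearSet J i).Nonempty}
  have hdis : Pairwise (Function.onFun Disjoint fun i : ι => nearSet J i) := fun i j hij =>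
    disjoint_nearSet i.2.1 j.2.1 fun h => hij (Subtype.ext h)
  have hcount : Countable ι := by
    have := Set.PairwiseDisjoint.countable_of_nonempty_interior (s := fun i => nearSet J i)
      (a := {i : Bool × ℝ | i.2 ∉ J ∧ (nearSet J i).Nonempty})
      (fun i hi j hj hij => disjoint_nearSet hi.1 hj.1 hij)
      (fun i hi => interior_nearSet_nonempty hi.1 hi.2)
    exact this.to_subtype
  have hU : J = ⋃ i : ι, nearSet J i := by
    apply Set.Subset.antisymm
    · intro s hs
      obtain ⟨i, hi, hi'⟩ := exists_mem_nearSet hJ hne hs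
      exact Set.mem_iUnion.2 ⟨⟨i, hi, s, hi'⟩, hi'⟩
    · exact Set.iUnion_subset fun i => nearSet_subset J i
  refine le_trans ?_ (tsum_halfEnergy_le (W := fun i : ι => nearSet J i)
    (fun i => measurableSet_nearSet hJ i) hdis (fun i => nearSet_subset J i) u)
  have h1 : ∫⁻ s in J, ‖u s‖ₑ ^ p * (1 / Metric.infEDist s Jᶜ ^ α) = ∑' i : ι,
      ∫⁻ s in nearSet J i, ENNReal.ofReal (|s - i.1.2| ^ (-α)) * ‖u s‖ₑ ^ p := by
    conv_lhs => rw [hU]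
    rw [lintegral_iUnion (fun i : ι => measurableSet_nearSet hJ i) hdis]
    refine tsum_congr fun i => setLIntegral_congr_fun (measurableSet_nearSet hJ i) fun s hs => ?_
    obtain ⟨h0, hd⟩ := infDist_eq_of_mem_nearSet hs
    have hd' : Metric.infEDist s Jᶜ = ENNReal.ofReal |s - i.1.2| := by
      rw [← hd, Metric.infDist, ENNReal.ofReal_toReal (Metric.infEDist_ne_top hne)]
    simp only [← hU]
    rw [hd', ENNReal.ofReal_rpow_of_pos h0, Real.rpow_neg h0.le,
      ENNReal.ofReal_inv_of_pos (by positivity), one_div, mul_comm]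
  rw [h1, ← ENNReal.tsum_mul_left]
  refine ENNReal.tsum_le_tsum fun i => ?_
  have hfin := lintegral_abs_sub_rpow_mul_ne_top (α := α) (by linarith : 0 < p) hu hc
    (fun h => i.2.1 (hs h)) (nearSet J i)
  have hm := measurableSet_nearSet hJ i.1
  have hst : ∀ s ∈ nearSet J i, ∀ r ∈ Set.Ioo (0 : ℝ) 1, i.1.2 + r * (s - i.1.2) ∈ nearSet J i :=
    fun s hs r hr => nearSet_star i.2.1 hs hr
  obtain ⟨⟨_ | _, a⟩, hi⟩ := i
  · exact hardyInt_mul_le_halfEnergy_of_star_left hp hα hm (fun s hs => hs.1) hst hu.measurable hfin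
  · exact hardyInt_mul_le_halfEnergy_of_star_right hp hα hm (fun s hs => hs.1) hst hu.measurable hfin

end FracHardy

/-! ### Slicing the energy along lines. -/

namespace FracHardy

variable {𝕜 : Type*} [RCLike 𝕜] {p α : ℝ}

/-- The same energy in the variables `(s, s + t)`, the form that polar coordinates produce on each
line. The indicator of `U ×ˢ U` records that both endpoints lie in `U`, though the segment between
them need not. -/
theorem halfEnergy_eq_translation {U : Set ℝ} (hU : MeasurableSet U) {u : ℝ → 𝕜}
    (hu : Measurable u) :
    halfEnergy p α U u = ∫⁻ t in Set.Ioi (0 : ℝ), ENNReal.ofReal (t ^ (-(1 + α))) *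
      ∫⁻ s, (U ×ˢ U).indicator (fun z => ‖u z.1 - u z.2‖ₑ ^ p) (s, s + t) := by
  have hD := measurableSet_ordered_pairs hU
  set D := {z : ℝ × ℝ | z.1 ∈ U ∧ z.2 ∈ U ∧ z.2 < z.1} with hDdef
  set F : ℝ × ℝ → ℝ≥0∞ := fun z => ‖u z.1 - u z.2‖ₑ ^ p *
    ENNReal.ofReal ((z.1 - z.2) ^ (-(1 + α))) with hFdef
  have hF : Measurable F := by fun_prop
  have hG : Measurable ((U ×ˢ U).indicator (fun z : ℝ × ℝ => ‖u z.1 - u z.2‖ₑ ^ p)) :=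
    Measurable.indicator (by fun_prop) (hU.prod hU)
  have h1 : halfEnergy p α U u = ∫⁻ s, ∫⁻ t, D.indicator F (s + t, s) := by
    rw [halfEnergy, ← lintegral_indicator hD]
    refine (lintegral_prod_symm _ (hF.indicator hD).aemeasurable).trans ?_
    exact lintegral_congr fun s => (lintegral_add_left_eq_self _ s).symm
  have h2 : ∀ s t, D.indicator F (s + t, s) = (Set.Ioi (0 : ℝ)).indicator (fun t =>
      ENNReal.ofReal (t ^ (-(1 + α))) *
        (U ×ˢ U).indicator (fun z => ‖u z.1 - u z.2‖ₑ ^ p) (s, s + t)) t := by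
    intro s t
    by_cases ht : 0 < t <;> by_cases h1 : s ∈ U <;> by_cases h2 : s + t ∈ U <;>
      simp [Set.indicator, hDdef, hFdef, ht, h1, h2]
    rw [mul_comm, ← enorm_neg, neg_sub]
  rw [h1]
  simp only [h2]
  simp only [lintegral_indicator (measurableSet_Ioi (a := (0 : ℝ)))]
  rw [lintegral_lintegral_swap]
  · exact lintegral_congr fun t => lintegral_const_mul' _ _ ENNReal.ofReal_ne_top
  · refine Measurable.aemeasurable ?_
    exact Measurable.mul (by fun_prop) (hG.comp (by fun_prop))

/-- With `y = x + t w`, the Jacobian `t^(n-1)` turns the kernel `t^(-(n+α))` into the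
one-dimensional kernel `t^(-(1+α))`. Each ordered pair occurs once, in the direction from `x` to
`y`, so no factor `1/2` appears. -/
theorem lintegral_kernel_polar {n : ℕ} [NeZero n] {G : Space n × Space n → ℝ≥0∞}
    (hG : Measurable G) :
    ∫⁻ z, G z / ‖z.1 - z.2‖ₑ ^ ((n : ℝ) + α) ∂((volume : Measure (Space n)).prod volume) =
      ∫⁻ w, (∫⁻ t in Set.Ioi (0 : ℝ), ENNReal.ofReal (t ^ (-(1 + α))) *
        ∫⁻ x, G (x, x + t • (w : Space n))) ∂surfaceMeasure n := by
  have hK : Measurable fun z : Space n × Space n => G z / ‖z.1 - z.2‖ₑ ^ ((n : ℝ) + α) := by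
    fun_prop
  have hK' : Measurable (Function.uncurry fun x h : Space n =>
      G (x, x + h) / ‖x - (x + h)‖ₑ ^ ((n : ℝ) + α)) :=
    hK.comp (f := fun z : Space n × Space n => (z.1, z.1 + z.2)) (by fun_prop)
  rw [lintegral_prod _ hK.aemeasurable]
  have h1 : ∀ x : Space n, ∫⁻ y, G (x, y) / ‖x - y‖ₑ ^ ((n : ℝ) + α) =
      ∫⁻ h, G (x, x + h) / ‖x - (x + h)‖ₑ ^ ((n : ℝ) + α) := fun x =>
    (lintegral_add_left_eq_self (fun y => G (x, y) / ‖x - y‖ₑ ^ ((n : ℝ) + α)) x).symm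
  simp only [h1]
  rw [lintegral_lintegral_swap hK'.aemeasurable, lintegral_polar
    (F := fun h => ∫⁻ x, G (x, x + h) / ‖x - (x + h)‖ₑ ^ ((n : ℝ) + α)) hK'.lintegral_prod_left']
  refine lintegral_congr fun w => setLIntegral_congr_fun measurableSet_Ioi fun t ht => ?_
  have ht : 0 < t := ht
  have hw : ‖(w : Space n)‖ = 1 := by simp
  have h2 : ∀ x : Space n, ‖x - (x + t • (w : Space n))‖ₑ = ENNReal.ofReal t := by
    intro x
    rw [sub_add_cancel_left, enorm_neg, ← ofReal_norm, norm_smul, hw, mul_one,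
      Real.norm_of_nonneg ht.le]
  have hn : (1 : ℝ) ≤ n := by exact_mod_cast NeZero.one_le
  simp only [h2, ENNReal.div_eq_inv_mul]
  have hpos : 0 < t ^ ((n : ℝ) + α) := by positivity
  rw [ENNReal.ofReal_rpow_of_pos ht, ← ENNReal.ofReal_inv_of_pos hpos,
    lintegral_const_mul' _ _ ENNReal.ofReal_ne_top, ← mul_assoc,
    ← ENNReal.ofReal_mul (by positivity)]
  congr 2
  rw [← Real.rpow_neg ht.le, ← Real.rpow_natCast, ← Real.rpow_add ht, Nat.cast_sub NeZero.one_le]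
  congr 1
  push_cast
  ring

theorem energy_eq_polar {n : ℕ} [NeZero n] {Ω : Set (Space n)}
    (hΩ : MeasurableSet Ω) {f : Space n → 𝕜} (hf : Measurable f) :
    energy p α Ω f = ∫⁻ w, (∫⁻ t in Set.Ioi (0 : ℝ), ENNReal.ofReal (t ^ (-(1 + α))) *
      ∫⁻ x, (Ω ×ˢ Ω).indicator (fun z => ‖f z.1 - f z.2‖ₑ ^ p) (x, x + t • (w : Space n)))
        ∂surfaceMeasure n := by
  rw [← lintegral_kernel_polar (Measurable.indicator (by fun_prop) (hΩ.prod hΩ)), energy,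
    ← lintegral_indicator (hΩ.prod hΩ)]
  refine lintegral_congr fun z => ?_
  by_cases hz : z ∈ Ω ×ˢ Ω <;> simp [hz]

/-- Fubini along the lines of direction `w`. -/
theorem exists_lintegral_slice {n : ℕ} [NeZero n] {w : Space n} (hw : ‖w‖ = 1) :
    ∃ P : (Fin (n - 1) → ℝ) → Space n, Continuous P ∧ ∀ F : Space n → ℝ≥0∞, Measurable F →
      ∫⁻ x, F x = ∫⁻ y, ∫⁻ s : ℝ, F (P y + s • w) := by
  obtain ⟨m, rfl⟩ : ∃ m, n = m + 1 := Nat.exists_eq_succ_of_ne_zero (NeZero.ne n)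
  obtain ⟨b, rfl⟩ := exists_orthonormalBasis_apply_eq (0 : Fin (m + 1)) hw
  rw [Nat.add_sub_cancel]
  -- In an orthonormal basis whose first vector is `w`, `P` parametrises the hyperplane orthogonal
  -- to `w`.
  let P : (Fin m → ℝ) → Space (m + 1) := fun y => b.repr.symm (WithLp.toLp 2 (Fin.cons 0 y))
  refine ⟨P, ?_, fun F hF => ?_⟩
  · exact b.repr.symm.continuous.comp ((PiLp.continuous_toLp 2 _).comp
      (continuous_const.finCons continuous_id))
  · have hP : ∀ s y, b.repr.symm (WithLp.toLp 2 (Fin.cons s y)) = P y + s • b 0 := by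
      intro s y
      apply b.repr.injective
      ext j
      refine Fin.cases ?_ (fun k => ?_) j <;> simp [P]
    have hF' : Measurable fun x : Space (m + 1) => F (b.repr.symm x) := by
      exact hF.comp b.repr.symm.continuous.measurable
    have hF'' : Measurable fun x : Fin (m + 1) → ℝ => F (b.repr.symm (WithLp.toLp 2 x)) :=
      hF'.comp (by fun_prop)
    rw [← b.measurePreserving_repr_symm.lintegral_comp hF,
      ← (PiLp.volume_preserving_toLp (Fin (m + 1))).lintegral_comp hF',
      ← ((volume_preserving_piFinSuccAbove (fun _ : Fin (m + 1) => ℝ) 0).symm _).lintegral_comp hF'']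
    simp only [MeasurableEquiv.piFinSuccAbove_symm_apply, Fin.insertNthEquiv,
      Fin.insertNth_zero', Equiv.coe_fn_mk, hP]
    refine lintegral_prod_symm (μ := (volume : Measure ℝ)) (ν := (volume : Measure (Fin m → ℝ)))
      (fun z => F (P z.2 + z.1 • b 0)) ?_
    have hPc : Continuous P := b.repr.symm.continuous.comp ((PiLp.continuous_toLp 2 _).comp
      (continuous_const.finCons continuous_id))
    exact (hF.comp (by fun_prop)).aemeasurable

/-- A sublevel set is a countable union, over rational bounds `q`, of projections of closed sets
along the compact interval `[-q, q]`. Such projections are closed. -/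
theorem measurable_dirDist {n : ℕ} {Ω : Set (Space n)} (hΩ : IsOpen Ω) :
    Measurable fun z : Space n × Space n => dirDist Ω z.1 z.2 := by
  refine measurable_of_Iio fun c => ?_
  have h : (fun z : Space n × Space n => dirDist Ω z.1 z.2) ⁻¹' Set.Iio c =
      ⋃ q : ℚ, ⋃ _ : ENNReal.ofReal q < c, Prod.snd '' {y : Set.Icc (-(q : ℝ)) q × Space n × Space n |
        y.2.2 + (y.1 : ℝ) • y.2.1 ∉ Ω} := by
    ext z
    simp only [dirDist, Set.mem_preimage, Set.mem_Iio, iInf_lt_iff, Set.mem_iUnion, Set.mem_image,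
      Set.mem_ofPred_eq, Prod.exists, Subtype.exists, exists_prop]
    constructor
    · rintro ⟨t, ht, htc⟩
      obtain ⟨q, hq0, htq, hqc⟩ := ENNReal.lt_iff_exists_rat_btwn.1 htc
      refine ⟨q, hqc, t, ?_, z.1, z.2, ht, rfl⟩
      have : ENNReal.ofReal |t| ≤ ENNReal.ofReal q := htq.le
      rw [ENNReal.ofReal_le_ofReal_iff (by exact_mod_cast hq0)] at this
      exact abs_le.1 this
    · rintro ⟨q, hq, t, htq, a, b, h, rfl⟩
      exact ⟨t, h, (ENNReal.ofReal_le_ofReal (abs_le.2 htq)).trans_lt hq⟩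
  rw [h]
  refine MeasurableSet.iUnion fun q => MeasurableSet.iUnion fun _ => IsClosed.measurableSet ?_
  refine isClosedMap_snd_of_compactSpace _ (hΩ.isClosed_compl.preimage (f := fun y :
    Set.Icc (-(q : ℝ)) q × Space n × Space n => y.2.2 + (y.1 : ℝ) • y.2.1) (by fun_prop))

theorem dirDist_add_smul {n : ℕ} (Ω : Set (Space n)) (w x : Space n) (s : ℝ) :
    dirDist Ω w (x + s • w) = Metric.infEDist s {s | x + s • w ∈ Ω}ᶜ := by
  apply le_antisymm
  · refine Metric.le_infEDist.2 fun t ht => ?_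
    refine iInf₂_le_of_le (t - s) (by simpa [add_assoc, ← add_smul] using ht) ?_
    rw [edist_dist, dist_comm, Real.dist_eq]
  · refine le_iInf₂ fun t ht => ?_
    refine (Metric.infEDist_le_edist_of_mem (y := s + t) ?_).trans_eq ?_
    · simpa [add_assoc, ← add_smul] using ht
    · rw [edist_dist, dist_comm, Real.dist_eq, add_sub_cancel_left]

end FracHardy

/-! ### The inequality on arbitrary open sets. -/

namespace FracHardy

variable {𝕜 : Type*} [RCLike 𝕜] {p α : ℝ}

theorem lintegral_translation_slice {n : ℕ} {w : Space n}
    {P : (Fin (n - 1) → ℝ) → Space n} (hP : Continuous P)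
    (hPF : ∀ F : Space n → ℝ≥0∞, Measurable F → ∫⁻ x, F x = ∫⁻ y, ∫⁻ s : ℝ, F (P y + s • w))
    {G : Space n × Space n → ℝ≥0∞} (hG : Measurable G) :
    ∫⁻ t in Set.Ioi (0 : ℝ), ENNReal.ofReal (t ^ (-(1 + α))) * ∫⁻ x, G (x, x + t • w) =
      ∫⁻ y, ∫⁻ t in Set.Ioi (0 : ℝ), ENNReal.ofReal (t ^ (-(1 + α))) *
        ∫⁻ s : ℝ, G (P y + s • w, P y + (s + t) • w) := by
  have h1 : ∀ t : ℝ, ENNReal.ofReal (t ^ (-(1 + α))) * ∫⁻ x, G (x, x + t • w) =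
      ∫⁻ y, ENNReal.ofReal (t ^ (-(1 + α))) * ∫⁻ s : ℝ, G (P y + s • w, P y + (s + t) • w) := by
    intro t
    rw [hPF (fun x => G (x, x + t • w)) (hG.comp (by fun_prop)),
      lintegral_const_mul' _ _ ENNReal.ofReal_ne_top]
    simp only [add_smul, add_assoc]
  simp only [h1]
  refine lintegral_lintegral_swap (Measurable.aemeasurable ?_)
  refine Measurable.mul (by fun_prop) ?_
  have : Measurable (fun z : (ℝ × (Fin (n - 1) → ℝ)) × ℝ =>
      G (P z.1.2 + z.2 • w, P z.1.2 + (z.2 + z.1.1) • w)) := hG.comp (by fun_prop)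
  exact this.lintegral_prod_right'

theorem lintegral_dirDist_slice {n : ℕ} {w : Space n}
    {P : (Fin (n - 1) → ℝ) → Space n}
    (hPF : ∀ F : Space n → ℝ≥0∞, Measurable F → ∫⁻ x, F x = ∫⁻ y, ∫⁻ s : ℝ, F (P y + s • w))
    {Ω : Set (Space n)} (hΩ : IsOpen Ω) {f : Space n → 𝕜} (hf : Continuous f) :
    ∫⁻ x in Ω, ‖f x‖ₑ ^ p * (1 / dirDist Ω w x ^ α) = ∫⁻ y,
      ∫⁻ s in {s : ℝ | P y + s • w ∈ Ω}, ‖f (P y + s • w)‖ₑ ^ p *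
        (1 / Metric.infEDist s {s : ℝ | P y + s • w ∈ Ω}ᶜ ^ α) := by
  have hΩm := hΩ.measurableSet
  have hd : Measurable fun x => dirDist Ω w x :=
    (measurable_dirDist hΩ).comp (f := fun x : Space n => (w, x))
      (measurable_const.prodMk measurable_id)
  have hF : Measurable (Ω.indicator fun x => ‖f x‖ₑ ^ p * (1 / dirDist Ω w x ^ α)) :=
    ((hf.measurable.enorm.pow_const p).mul (measurable_const.div (hd.pow_const α))).indicator hΩm
  rw [← lintegral_indicator hΩm, hPF _ hF]
  refine lintegral_congr fun y => ?_
  have hJ : MeasurableSet {s : ℝ | P y + s • w ∈ Ω} :=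
    (hΩ.preimage (f := fun s : ℝ => P y + s • w) (by fun_prop)).measurableSet
  rw [← lintegral_indicator hJ]
  refine lintegral_congr fun s => ?_
  by_cases h : P y + s • w ∈ Ω
  · rw [Set.indicator_of_mem h, Set.indicator_of_mem (by exact h), dirDist_add_smul]
  · rw [Set.indicator_of_notMem h, Set.indicator_of_notMem (by exact h)]

theorem hardyInt_mul_le_directional {n : ℕ} [NeZero n] (hp : 1 < p) (hα : 1 < α)
    {Ω : Set (Space n)} (hΩ : IsOpen Ω) {f : Space n → 𝕜} (hf : Continuous f)
    (hc : HasCompactSupport f) (hs : tsupport f ⊆ Ω) {w : Space n} (hw : ‖w‖ = 1) :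
    hardyInt p α * ∫⁻ x in Ω, ‖f x‖ₑ ^ p * (1 / dirDist Ω w x ^ α) ≤
      ∫⁻ t in Set.Ioi (0 : ℝ), ENNReal.ofReal (t ^ (-(1 + α))) *
        ∫⁻ x, (Ω ×ˢ Ω).indicator (fun z => ‖f z.1 - f z.2‖ₑ ^ p) (x, x + t • w) := by
  obtain ⟨P, hP, hPF⟩ := exists_lintegral_slice hw
  have hΩm := hΩ.measurableSet
  have hfm := hf.measurable
  have hGm : Measurable ((Ω ×ˢ Ω).indicator (fun z => ‖f z.1 - f z.2‖ₑ ^ p)) :=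
    Measurable.indicator (by fun_prop) (hΩm.prod hΩm)
  rw [lintegral_dirDist_slice hPF hΩ hf, lintegral_translation_slice hP hPF hGm]
  refine (lintegral_const_mul_le _ _).trans (lintegral_mono fun y => ?_)
  have hiso : Isometry fun s : ℝ => P y + s • w := by
    refine Isometry.of_dist_eq fun a b => ?_
    rw [dist_add_left, dist_eq_norm, ← sub_smul, norm_smul, hw, mul_one, Real.dist_eq,
      Real.norm_eq_abs]
  -- The line is an isometric, hence closed, embedding, so the slice of `f` keeps a compact support
  -- inside the slice of `Ω`.
  have hJ : IsOpen {s : ℝ | P y + s • w ∈ Ω} := hΩ.preimage hiso.continuous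
  have h1 := halfEnergy_eq_translation (p := p) (α := α) hJ.measurableSet
    (u := fun s : ℝ => f (P y + s • w)) (hfm.comp hiso.continuous.measurable)
  have h2 := hardyInt_mul_le_halfEnergy (u := fun s : ℝ => f (P y + s • w)) hp hα hJ
    (hf.comp hiso.continuous) (hc.comp_isClosedEmbedding hiso.isClosedEmbedding)
    ((tsupport_comp_subset_preimage f hiso.continuous).trans (Set.preimage_mono hs))
  rw [h1] at h2
  exact h2

theorem one_sub_rpow_le {p α r : ℝ} (hα : 1 < α) (hαp : α < p) (hr : r ∈ Set.Ioo (0 : ℝ) 1) :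
    0 ≤ 1 - r ^ ((α - 1) / p) ∧ 1 - r ^ ((α - 1) / p) ≤ 1 - r := by
  have hp0 : 0 < p := by linarith
  have h1 : r ^ ((α - 1) / p) ≤ 1 :=
    Real.rpow_le_one hr.1.le hr.2.le (div_nonneg (by linarith) hp0.le)
  have h2 : r ≤ r ^ ((α - 1) / p) :=
    Real.self_le_rpow_of_le_one hr.1.le hr.2.le ((div_le_one hp0).2 (by linarith))
  constructor <;> linarith

/-- Since `(α-1)/p < 1`, the numerator is at most `(1-r)^p`, and `α < p` makes `(1-r)^(p-1-α)`
integrable at `1`. This identifies the Bochner integral in `hardyConst` with the lower integral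
`hardyInt`. -/
theorem integrableOn_hardy (hα : 1 < α) (hαp : α < p) :
    IntegrableOn (fun r : ℝ => |1 - r ^ ((α - 1) / p)| ^ p / (1 - r) ^ (1 + α))
      (Set.Ioo 0 1) := by
  have hp0 : 0 < p := by linarith
  have h1 : IntegrableOn (fun r : ℝ => (1 - r) ^ (p - (1 + α))) (Set.Ioo 0 1) := by
    have h := intervalIntegral.intervalIntegrable_rpow' (a := 0) (b := 1) (r := p - (1 + α))
      (by linarith)
    have h := (h.comp_sub_left 1).symm
    simp only [sub_zero, sub_self] at h
    exact ((intervalIntegrable_iff_integrableOn_Ioo_of_le zero_le_one).1 h)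
  refine h1.mono' (Measurable.aestronglyMeasurable (by fun_prop)) ?_
  filter_upwards [ae_restrict_mem measurableSet_Ioo] with r hr
  obtain ⟨h2, h3⟩ := one_sub_rpow_le hα hαp hr
  have h4 : 0 < 1 - r := by linarith [hr.2]
  rw [abs_of_nonneg h2, Real.norm_of_nonneg (by positivity), Real.rpow_sub h4]
  gcongr

theorem ofReal_integral_hardy (hα : 1 < α) (hαp : α < p) :
    ENNReal.ofReal (∫ r in (0 : ℝ)..1, |1 - r ^ ((α - 1) / p)| ^ p / (1 - r) ^ (1 + α)) =
      hardyInt p α := by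
  rw [intervalIntegral.integral_of_le zero_le_one, integral_Ioc_eq_integral_Ioo,
    ofReal_integral_eq_lintegral_ofReal (integrableOn_hardy hα hαp), hardyInt]
  · refine setLIntegral_congr_fun measurableSet_Ioo fun r hr => ?_
    obtain ⟨h2, h3⟩ := one_sub_rpow_le hα hαp hr
    have h4 : 0 < 1 - r := by linarith [hr.2]
    rw [abs_of_nonneg h2, ENNReal.ofReal_rpow_of_nonneg h2 (by linarith),
      ← ENNReal.ofReal_mul (by positivity), Real.rpow_neg h4.le]
    congr 1
    field_simp
  · filter_upwards [ae_restrict_mem measurableSet_Ioo] with r hr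
    have h4 : 0 < 1 - r := by linarith [hr.2]
    positivity

theorem hardyConst_nonneg {n : ℕ} [NeZero n] (hα : 1 < α) : 0 ≤ hardyConst n p α := by
  have h1 : 0 < Real.Gamma ((1 + α) / 2) := Real.Gamma_pos_of_pos (by linarith)
  have h2 : 0 < Real.Gamma (((n : ℝ) + α) / 2) := Real.Gamma_pos_of_pos (by positivity)
  refine mul_nonneg (by positivity) (intervalIntegral.integral_nonneg zero_le_one fun r hr => ?_)
  have : 0 ≤ 1 - r := by linarith [hr.2]
  positivity

theorem ofReal_hardyConst {n : ℕ} [NeZero n] (hα : 1 < α) (hαp : α < p) {e : Space n}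
    (he : ‖e‖ = 1) :
    ENNReal.ofReal (hardyConst n p α) =
      (∫⁻ w, ENNReal.ofReal (|inner ℝ e (w : Space n)| ^ α) ∂surfaceMeasure n) * hardyInt p α := by
  have h1 : 0 < Real.Gamma ((1 + α) / 2) := Real.Gamma_pos_of_pos (by linarith)
  have h2 : 0 < Real.Gamma (((n : ℝ) + α) / 2) := Real.Gamma_pos_of_pos (by positivity)
  rw [lintegral_sphere_abs_inner_rpow he (by linarith), ← ofReal_integral_hardy hα hαp,
    ← ENNReal.ofReal_mul (by positivity), hardyConst]

theorem lintegral_sphere_abs_coord {n : ℕ} (i : Fin n) :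
    ∫⁻ w, ENNReal.ofReal (|(w : Space n) i| ^ α) ∂surfaceMeasure n =
      ∫⁻ w, ENNReal.ofReal (|inner ℝ (EuclideanSpace.single i (1 : ℝ)) (w : Space n)| ^ α)
        ∂surfaceMeasure n := by
  simp [EuclideanSpace.inner_single_left]

theorem lintegral_sphere_pos {n : ℕ} [NeZero n] (hα : 1 < α) {e : Space n} (he : ‖e‖ = 1) :
    ∫⁻ w, ENNReal.ofReal (|inner ℝ e (w : Space n)| ^ α) ∂surfaceMeasure n ≠ 0 ∧
    ∫⁻ w, ENNReal.ofReal (|inner ℝ e (w : Space n)| ^ α) ∂surfaceMeasure n ≠ ∞ := by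
  have h1 : 0 < Real.Gamma ((1 + α) / 2) := Real.Gamma_pos_of_pos (by linarith)
  have h2 : 0 < Real.Gamma (((n : ℝ) + α) / 2) := Real.Gamma_pos_of_pos (by positivity)
  rw [lintegral_sphere_abs_inner_rpow he (by linarith)]
  refine ⟨?_, ENNReal.ofReal_ne_top⟩
  rw [Ne, ENNReal.ofReal_eq_zero, not_le]
  positivity

/-- The sharp fractional Hardy inequality on an arbitrary open set. -/
theorem hardy_mWeight {n : ℕ} [NeZero n] (hp : 1 < p) (hα : 1 < α) (hαp : α < p)
    {Ω : Set (Space n)} (hΩ : IsOpen Ω) {f : Space n → 𝕜} (hf : Continuous f)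
    (hc : HasCompactSupport f) (hs : tsupport f ⊆ Ω) :
    ENNReal.ofReal (hardyConst n p α) * weightedNorm p Ω (mWeight α Ω) f ≤ energy p α Ω f := by
  have he : ‖EuclideanSpace.single (⊤ : Fin n) (1 : ℝ)‖ = 1 := by simp
  obtain ⟨hS0, hST⟩ := lintegral_sphere_pos (n := n) hα he
  have hd := measurable_dirDist hΩ
  have hd' : Measurable (Function.uncurry fun (x : Space n) (w : Metric.sphere (0 : Space n) 1) =>
      ‖f x‖ₑ ^ p * (1 / dirDist Ω (w : Space n) x ^ α)) := by
    have hfm := hf.measurable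
    have : Measurable fun z : Space n × Metric.sphere (0 : Space n) 1 =>
      dirDist Ω (z.2 : Space n) z.1 := hd.comp
        (f := fun z : Space n × Metric.sphere (0 : Space n) 1 => ((z.2 : Space n), z.1)) (by fun_prop)
    unfold Function.uncurry
    fun_prop
  rw [ofReal_hardyConst hα hαp he]
  unfold weightedNorm mWeight
  rw [lintegral_sphere_abs_coord]
  set S := ∫⁻ w, ENNReal.ofReal (|inner ℝ (EuclideanSpace.single (⊤ : Fin n) (1 : ℝ))
    (w : Space n)| ^ α) ∂surfaceMeasure n
  have h1 : ∀ x, ‖f x‖ₑ ^ p * ((∫⁻ w, 1 / dirDist Ω (w : Space n) x ^ α ∂surfaceMeasure n) / S) =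
      S⁻¹ * ∫⁻ w, ‖f x‖ₑ ^ p * (1 / dirDist Ω (w : Space n) x ^ α) ∂surfaceMeasure n := by
    intro x
    rw [lintegral_const_mul' _ _ (by simp [show 0 ≤ p by linarith]), ENNReal.div_eq_inv_mul]
    ring
  simp only [h1]
  -- The factor `S` in `hardyConst` cancels the normalisation of `mWeight`, leaving one inequality
  -- per direction.
  rw [lintegral_const_mul' _ _ (ENNReal.inv_ne_top.2 hS0), mul_comm S, mul_assoc, ← mul_assoc S,
    ENNReal.mul_inv_cancel hS0 hST, one_mul, lintegral_lintegral_swap hd'.aemeasurable,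
    energy_eq_polar hΩ.measurableSet hf.measurable]
  refine (lintegral_const_mul_le _ _).trans (lintegral_mono fun w => ?_)
  exact hardyInt_mul_le_directional hp hα hΩ hf hc hs (by simp)

end FracHardy

/-! ### Convex sets: comparison of the two weights. -/

namespace FracHardy

variable {𝕜 : Type*} [RCLike 𝕜] {p α : ℝ} {n : ℕ}

theorem _root_.IsPreconnected.inter_frontier {X : Type*} [TopologicalSpace X] {S Ω : Set X}
    (hS : IsPreconnected S) (h1 : (S ∩ Ω).Nonempty) (h2 : (S ∩ Ωᶜ).Nonempty) :
    (S ∩ frontier Ω).Nonempty := by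
  by_contra hf
  have hf' : ∀ z ∈ S, z ∉ frontier Ω := fun z hz hzf => hf ⟨z, hz, hzf⟩
  obtain ⟨x, hxS, hx⟩ := h1
  obtain ⟨y, hyS, hy⟩ := h2
  have hsplit : ∀ z ∈ S, z ∈ interior Ω ∨ z ∈ (closure Ω)ᶜ := by
    intro z hz
    by_contra! h
    exact hf' z hz ⟨by simpa using h.2, h.1⟩
  obtain ⟨z, -, hz1, hz2⟩ := hS _ _ isOpen_interior isClosed_closure.isOpen_compl hsplit
    ⟨x, hxS, (hsplit x hxS).resolve_right fun h => h (subset_closure hx)⟩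
    ⟨y, hyS, (hsplit y hyS).resolve_left fun h => hy (interior_subset h)⟩
  exact hz2 (subset_closure (interior_subset hz1))

theorem infEDist_frontier_le_edist {Ω : Set (Space n)} {x y : Space n} (hx : x ∈ Ω) (hy : y ∉ Ω) :
    Metric.infEDist x (frontier Ω) ≤ edist x y := by
  obtain ⟨z, hz, hzf⟩ := (convex_segment (𝕜 := ℝ) x y).isPreconnected.inter_frontier
    ⟨x, left_mem_segment ℝ x y, hx⟩ ⟨y, right_mem_segment ℝ x y, hy⟩
  refine (Metric.infEDist_le_edist_of_mem hzf).trans ?_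
  rw [edist_dist, edist_dist]
  apply ENNReal.ofReal_le_ofReal
  have := dist_add_dist_of_mem_segment hz
  linarith [dist_nonneg (x := z) (y := y)]

/-- The orthogonal projection of `x` to the supporting hyperplane is outside `Ω`, so the segment to
it meets the frontier. -/
theorem infEDist_frontier_le_inner {Ω : Set (Space n)} {z e : Space n} (he : ‖e‖ = 1)
    (hΩ : ∀ y ∈ Ω, 0 < inner ℝ e (y - z)) {x : Space n} (hx : x ∈ Ω) :
    Metric.infEDist x (frontier Ω) ≤ ENNReal.ofReal (inner ℝ e (x - z)) := by
  have hx0 := hΩ x hx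
  refine (infEDist_frontier_le_edist (y := x - inner ℝ e (x - z) • e) hx fun h => ?_).trans_eq ?_
  · have := hΩ _ h
    rw [show x - inner ℝ e (x - z) • e - z = (x - z) - inner ℝ e (x - z) • e by abel,
      inner_sub_right, inner_smul_right, real_inner_self_eq_norm_sq, he] at this
    linarith
  · rw [edist_dist, dist_eq_norm, sub_sub_cancel, norm_smul, he, mul_one,
      Real.norm_of_nonneg hx0.le]

/-- At the boundary point of a convex open set nearest to `x`, the set lies between the ball around
`x` and a half-space. -/
theorem exists_nearest_supporting {Ω : Set (Space n)} (hΩ : IsOpen Ω) (hconv : Convex ℝ Ω)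
    (hne : (frontier Ω).Nonempty) {x : Space n} (hx : x ∈ Ω) :
    ∃ (z e : Space n) (d : ℝ), 0 < d ∧ ‖e‖ = 1 ∧ x = z + d • e ∧ Metric.ball x d ⊆ Ω ∧
      (∀ y ∈ Ω, 0 < inner ℝ e (y - z)) ∧ Metric.infEDist x (frontier Ω) = ENNReal.ofReal d := by
  obtain ⟨z, hz, hd⟩ := isClosed_frontier.exists_infDist_eq_dist hne x
  have hzΩ : z ∉ Ω := by
    rw [hΩ.frontier_eq] at hz
    exact hz.2
  have hball : Metric.ball x (dist x z) ⊆ Ω := by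
    intro y hy
    by_contra hyΩ
    have h := infEDist_frontier_le_edist hx hyΩ
    rw [← ENNReal.toReal_le_toReal (Metric.infEDist_ne_top hne) (edist_ne_top _ _),
      ← Metric.infDist, hd, ← dist_edist, dist_comm x y] at h
    exact absurd (Metric.mem_ball.1 hy) (not_lt.2 h)
  have hd0 : 0 < dist x z := dist_pos.2 (by rintro rfl; exact hzΩ hx)
  obtain ⟨φ, hφ⟩ := geometric_hahn_banach_open_point hconv hΩ hzΩ
  set v := (InnerProductSpace.toDual ℝ (Space n)).symm φ with hv
  have hφv : ∀ y, φ y = inner ℝ v y := fun y => by rw [hv, InnerProductSpace.toDual_symm_apply]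
  have hv0 : v ≠ 0 := by
    intro h0
    have := hφ x hx
    simp [hφv, h0] at this
  have hvn : 0 < ‖v‖ := norm_pos_iff.2 hv0
  -- Hahn–Banach places `Ω` where `φ` is below `φ z`; the sign makes `e` the inner unit normal.
  set e : Space n := (-‖v‖⁻¹) • v with he'
  have he : ‖e‖ = 1 := by
    rw [he', norm_smul, norm_neg, norm_inv, norm_norm, inv_mul_cancel₀ hvn.ne']
  have hH : ∀ y ∈ Ω, 0 < inner ℝ e (y - z) := by
    intro y hy
    have h1 := hφ y hy
    rw [hφv, hφv] at h1
    rw [he', real_inner_smul_left, inner_sub_right]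
    have := inv_pos.2 hvn
    nlinarith
  -- Moving from `x` by less than `dist x z` against `e` stays in the ball, hence on the positive
  -- side of the hyperplane.
  have hle : dist x z ≤ inner ℝ e (x - z) := by
    refine le_of_forall_lt_imp_le_of_dense fun t ht => ?_
    by_cases ht0 : 0 ≤ t
    · have hmem : x - t • e ∈ Metric.ball x (dist x z) := by
        rw [Metric.mem_ball, dist_eq_norm, sub_sub_cancel_left, norm_neg, norm_smul, he, mul_one,
          Real.norm_of_nonneg ht0]
        exact ht
      have h1 := hH _ (hball hmem)
      rw [show x - t • e - z = (x - z) - t • e by abel, inner_sub_right, inner_smul_right,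
        real_inner_self_eq_norm_sq, he] at h1
      linarith
    · exact (not_le.1 ht0).le.trans (hH x hx).le
  -- This is the equality case of Cauchy–Schwarz: the component of `x - z` along `e` is at least its
  -- norm.
  have hxz : x - z - dist x z • e = 0 := by
    have h1 := norm_sub_sq_real (x - z) (dist x z • e)
    rw [inner_smul_right, norm_smul, he, mul_one, Real.norm_of_nonneg hd0.le, ← dist_eq_norm x z,
      real_inner_comm] at h1
    rw [← norm_eq_zero]
    have h2 : 0 ≤ ‖x - z - dist x z • e‖ := norm_nonneg _
    nlinarith
  refine ⟨z, e, dist x z, hd0, he, ?_, hball, hH, ?_⟩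
  · rw [← sub_eq_zero, ← hxz]; abel
  · rw [← hd, Metric.infDist, ENNReal.ofReal_toReal (Metric.infEDist_ne_top hne)]

/-- The line in direction `w` leaves the supporting half-space within `d / |⟨e, w⟩|`. Averaging
`|⟨e, w⟩|^α / d^α` over the sphere gives `d^(-α)` after normalisation. -/
theorem dWeight_le_mWeight [NeZero n] (hα : 1 < α) {Ω : Set (Space n)} (hΩ : IsOpen Ω)
    (hconv : Convex ℝ Ω) {x : Space n} (hx : x ∈ Ω) : dWeight α Ω x ≤ mWeight α Ω x := by
  have hα0 : 0 < α := by linarith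
  rcases (frontier Ω).eq_empty_or_nonempty with hemp | hne
  · simp [dWeight, hemp, hα0]
  obtain ⟨z, e, d, hd, he, hxz, -, hH, hdist⟩ := exists_nearest_supporting hΩ hconv hne hx
  have he' : ‖EuclideanSpace.single (⊤ : Fin n) (1 : ℝ)‖ = 1 := by simp
  obtain ⟨hS0, hST⟩ := lintegral_sphere_pos (n := n) hα he
  -- The sphere integral is evaluated and folded back in order to replace the last coordinate vector
  -- by `e`.
  rw [dWeight, mWeight, hdist, lintegral_sphere_abs_coord,
    lintegral_sphere_abs_inner_rpow he' (by linarith),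
    ← lintegral_sphere_abs_inner_rpow he (by linarith), ENNReal.le_div_iff_mul_le (Or.inl hS0)
    (Or.inl hST), ← lintegral_const_mul _ (by fun_prop)]
  refine lintegral_mono fun w => ?_
  rcases eq_or_ne (inner ℝ e (w : Space n)) 0 with h0 | h0
  · simp [h0, hα0.ne']
  have hw0 : 0 < |inner ℝ e (w : Space n)| := abs_pos.2 h0
  have h1 : dirDist Ω (w : Space n) x ≤ ENNReal.ofReal (d / |inner ℝ e (w : Space n)|) := by
    -- This parameter is where the line meets the hyperplane through `z`.
    refine iInf₂_le_of_le (-(d / inner ℝ e (w : Space n))) (fun hmem => ?_) ?_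
    · have := hH _ hmem
      rw [hxz, show z + d • e + -(d / inner ℝ e (w : Space n)) • (w : Space n) - z =
        d • e - (d / inner ℝ e (w : Space n)) • (w : Space n) by rw [neg_smul]; abel,
        inner_sub_right, inner_smul_right, inner_smul_right, real_inner_self_eq_norm_sq, he,
        div_mul_cancel₀ _ h0] at this
      linarith
    · rw [abs_neg, abs_div, abs_of_pos hd]
  calc 1 / ENNReal.ofReal d ^ α * ENNReal.ofReal (|inner ℝ e (w : Space n)| ^ α)
      = 1 / ENNReal.ofReal (d / |inner ℝ e (w : Space n)|) ^ α := by
        rw [ENNReal.ofReal_rpow_of_pos hd, ENNReal.ofReal_rpow_of_pos (by positivity), one_div,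
          one_div, ← ENNReal.ofReal_inv_of_pos (by positivity),
          ← ENNReal.ofReal_inv_of_pos (by positivity), ← ENNReal.ofReal_mul (by positivity),
          Real.div_rpow hd.le hw0.le, inv_div, mul_comm, div_eq_mul_inv]
    _ ≤ 1 / dirDist Ω (w : Space n) x ^ α := by gcongr

theorem weightedNorm_dWeight_le [NeZero n] (hα : 1 < α) {Ω : Set (Space n)} (hΩ : IsOpen Ω)
    (hconv : Convex ℝ Ω) (f : Space n → 𝕜) :
    weightedNorm p Ω (dWeight α Ω) f ≤ weightedNorm p Ω (mWeight α Ω) f :=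
  setLIntegral_mono' hΩ.measurableSet fun x hx => by
    gcongr
    exact dWeight_le_mWeight hα hΩ hconv hx

end FracHardy

/-! ### Tools for product test functions on the half-space. -/

namespace FracHardy

variable {𝕜 : Type*} [RCLike 𝕜] {p α : ℝ} {n : ℕ}

theorem lintegral_coord_mul_prod (i : Fin n) {a b : ℝ → ℝ≥0∞} (ha : Measurable a)
    (hb : Measurable b) :
    ∫⁻ x : Space n, a (x i) * ∏ j ∈ Finset.univ.erase i, b (x j) =
      (∫⁻ t, a t) * (∫⁻ t, b t) ^ (n - 1) := by
  have h := lintegral_prod_space (F := fun j : Fin n => if j = i then a else b)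
    (fun j => by split_ifs <;> assumption)
  have h1 : ∀ x : Space n, a (x i) * ∏ j ∈ Finset.univ.erase i, b (x j) =
      ∏ j, (if j = i then a else b) (x j) := by
    intro x
    rw [← Finset.mul_prod_erase _ _ (Finset.mem_univ i), if_pos rfl]
    congr 1
    exact Finset.prod_congr rfl fun j hj => by rw [if_neg (Finset.ne_of_mem_erase hj)]
  rw [lintegral_congr h1, h, ← Finset.mul_prod_erase _ _ (Finset.mem_univ i), if_pos rfl,
    Finset.prod_congr rfl (g := fun _ => ∫⁻ t, b t)
      fun j hj => by rw [if_neg (Finset.ne_of_mem_erase hj)]]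
  rw [Finset.prod_const, Finset.card_erase_of_mem (Finset.mem_univ i), Finset.card_univ,
    Fintype.card_fin]

/-- Scaling in `t` gives `|c|^α`, and `K 0 = 0` covers `c = 0`. With `c` a coordinate of the
direction `w`, this creates the weight `|w i|^α` on the sphere. -/
theorem lintegral_kernel_comp_mul (hα : 0 < α) {K : ℝ → ℝ≥0∞} (hK : ∀ t, K (-t) = K t)
    (hK0 : K 0 = 0) (c : ℝ) :
    ∫⁻ t in Set.Ioi (0 : ℝ), ENNReal.ofReal (t ^ (-(1 + α))) * K (t * c) =
      ENNReal.ofReal (|c| ^ α) * ∫⁻ t in Set.Ioi (0 : ℝ), ENNReal.ofReal (t ^ (-(1 + α))) * K t := by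
  rcases eq_or_ne c 0 with rfl | hc
  · simp [hK0, hα.ne']
  have hc0 : 0 < |c| := abs_pos.2 hc
  have hKc : ∀ t, K (t * c) = K (|c| * t) := by
    intro t
    rcases abs_choice c with h | h <;> rw [h]
    · rw [mul_comm]
    · rw [← hK]; congr 1; ring
  rw [← setLIntegral_Ioi_comp_mul_left hc0 (fun t => ENNReal.ofReal (t ^ (-(1 + α))) * K t),
    ← mul_assoc, ← ENNReal.ofReal_mul (by positivity),
    ← lintegral_const_mul' _ _ ENNReal.ofReal_ne_top]
  refine setLIntegral_congr_fun measurableSet_Ioi fun t ht => ?_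
  have ht : 0 < t := ht
  simp only [hKc]
  rw [← mul_assoc, ← ENNReal.ofReal_mul (by positivity), Real.mul_rpow hc0.le ht.le]
  congr 2
  rw [← mul_assoc, ← Real.rpow_add_one hc0.ne', ← Real.rpow_add hc0,
    show α + 1 + -(1 + α) = 0 by ring, Real.rpow_zero, one_mul]

/-- Minkowski's inequality for the measure carrying the kernel as density on `Ω ×ˢ Ω`; it separates
the main part of the energy from the cutoff error. -/
theorem energy_le_of_enorm_sub_le (hp : 1 < p) {Ω : Set (Space n)} (hΩ : MeasurableSet Ω)
    {f : Space n → 𝕜} {a b : Space n × Space n → ℝ≥0∞} (ha : Measurable a)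
    (hb : Measurable b) (h : ∀ z, ‖f z.1 - f z.2‖ₑ ≤ a z + b z) :
    energy p α Ω f ≤
      ((∫⁻ z, (Ω ×ˢ Ω).indicator (fun z => a z ^ p) z / ‖z.1 - z.2‖ₑ ^ ((n : ℝ) + α)
          ∂((volume : Measure (Space n)).prod volume)) ^ (1 / p) +
        (∫⁻ z, (Ω ×ˢ Ω).indicator (fun z => b z ^ p) z / ‖z.1 - z.2‖ₑ ^ ((n : ℝ) + α)
          ∂((volume : Measure (Space n)).prod volume)) ^ (1 / p)) ^ p := by
  have hp0 : 0 < p := by linarith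
  set μ := (((volume : Measure (Space n)).prod volume).restrict (Ω ×ˢ Ω)).withDensity
    (fun z => (‖z.1 - z.2‖ₑ ^ ((n : ℝ) + α))⁻¹) with hμ
  have hμi : ∀ F : Space n × Space n → ℝ≥0∞, Measurable F → ∫⁻ z, F z ∂μ =
      ∫⁻ z, (Ω ×ˢ Ω).indicator F z / ‖z.1 - z.2‖ₑ ^ ((n : ℝ) + α)
        ∂((volume : Measure (Space n)).prod volume) := by
    intro F hF
    rw [hμ, lintegral_withDensity_eq_lintegral_mul _ (by fun_prop) hF,
      ← lintegral_indicator (hΩ.prod hΩ)]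
    refine lintegral_congr fun z => ?_
    by_cases hz : z ∈ Ω ×ˢ Ω
    · simp only [Set.indicator_of_mem hz, Pi.mul_apply, ENNReal.div_eq_inv_mul]
    · simp only [Set.indicator_of_notMem hz, ENNReal.zero_div]
  have hM := ENNReal.lintegral_Lp_add_le (μ := μ) ha.aemeasurable hb.aemeasurable hp.le
  rw [hμi _ (ha.pow_const p), hμi _ (hb.pow_const p)] at hM
  have h2 := ENNReal.rpow_le_rpow hM hp0.le
  rw [← ENNReal.rpow_mul, one_div_mul_cancel hp0.ne', ENNReal.rpow_one] at h2
  refine le_trans ?_ h2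
  rw [hμi _ ((ha.add hb).pow_const p), energy, ← lintegral_indicator (hΩ.prod hΩ)]
  refine lintegral_mono fun z => ?_
  by_cases hz : z ∈ Ω ×ˢ Ω
  · simp only [Set.indicator_of_mem hz]
    gcongr
    exact h z
  · simp [hz]

theorem abs_prod_sub_prod_le {ι : Type*} (s : Finset ι) {a b : ι → ℝ}
    (ha : ∀ j, 0 ≤ a j ∧ a j ≤ 1) (hb : ∀ j, 0 ≤ b j ∧ b j ≤ 1) :
    |∏ j ∈ s, a j - ∏ j ∈ s, b j| ≤ ∑ j ∈ s, |a j - b j| := by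
  classical
  induction s using Finset.induction_on with
  | empty => simp
  | insert k s hk ih =>
    rw [Finset.prod_insert hk, Finset.prod_insert hk, Finset.sum_insert hk]
    have h1 : |∏ j ∈ s, a j| ≤ 1 := by
      rw [abs_of_nonneg (Finset.prod_nonneg fun j _ => (ha j).1)]
      exact Finset.prod_le_one (fun j _ => (ha j).1) fun j _ => (ha j).2
    have h2 : |b k| ≤ 1 := by rw [abs_of_nonneg (hb k).1]; exact (hb k).2
    calc |a k * ∏ j ∈ s, a j - b k * ∏ j ∈ s, b j|
        = |(a k - b k) * ∏ j ∈ s, a j + b k * (∏ j ∈ s, a j - ∏ j ∈ s, b j)| := by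
          congr 1; ring
      _ ≤ |a k - b k| * |∏ j ∈ s, a j| + |b k| * |∏ j ∈ s, a j - ∏ j ∈ s, b j| := by
          rw [← abs_mul, ← abs_mul]; exact abs_add_le _ _
      _ ≤ |a k - b k| * 1 + 1 * ∑ j ∈ s, |a j - b j| := by gcongr
      _ = _ := by ring

/-- A smooth cutoff equal to `1` on `[-1, 1]` and supported in `[-2, 2]`. -/
noncomputable def bump : ContDiffBump (0 : ℝ) := ⟨1, 2, one_pos, one_lt_two⟩

theorem bump_mem (t : ℝ) : 0 ≤ bump t ∧ bump t ≤ 1 := ⟨bump.nonneg, bump.le_one⟩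

theorem bump_eq_one {t : ℝ} (ht : |t| ≤ 1) : bump t = 1 :=
  bump.one_of_mem_closedBall (by simpa [bump] using ht)

theorem bump_eq_zero {t : ℝ} (ht : 2 ≤ |t|) : bump t = 0 :=
  bump.zero_of_le_dist (by simpa [bump] using ht)

theorem exists_bump_lipschitz : ∃ L : ℝ, 0 < L ∧ ∀ s t, |bump s - bump t| ≤ L * |s - t| := by
  obtain ⟨C, hC⟩ := (bump.contDiff (n := 1)).lipschitzWith_of_hasCompactSupport
    bump.hasCompactSupport one_ne_zero
  refine ⟨C + 1, by positivity, fun s t => ?_⟩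
  have := hC.dist_le_mul s t
  rw [Real.dist_eq, Real.dist_eq] at this
  nlinarith [abs_nonneg (s - t)]

/-- The cutoff in the coordinates other than `i`, at scale `R`. -/
noncomputable def transCutoff (i : Fin n) (R : ℝ) (x : Space n) : ℝ :=
  ∏ j ∈ Finset.univ.erase i, bump (x j / R)

theorem contDiff_transCutoff (i : Fin n) (R : ℝ) {m : ℕ∞} : ContDiff ℝ m (transCutoff i R) := by
  unfold transCutoff
  refine contDiff_prod fun j _ => bump.contDiff.comp (ContDiff.div_const ?_ R)
  fun_prop

theorem abs_transCutoff_sub_le (i : Fin n) {L : ℝ} (hL : 0 < L)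
    (hbump : ∀ s t, |bump s - bump t| ≤ L * |s - t|) {R : ℝ} (hR : 0 < R) (x y : Space n) :
    |transCutoff i R x - transCutoff i R y| ≤ min 1 (‖x - y‖ * (n * L / R)) := by
  refine le_min ?_ ?_
  · have h : ∀ x : Space n, 0 ≤ transCutoff i R x ∧ transCutoff i R x ≤ 1 := fun x =>
      ⟨Finset.prod_nonneg fun j _ => (bump_mem _).1,
        Finset.prod_le_one (fun j _ => (bump_mem _).1) fun j _ => (bump_mem _).2⟩
    rw [abs_le]
    constructor <;> linarith [(h x).1, (h x).2, (h y).1, (h y).2]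
  · refine (abs_prod_sub_prod_le _ (fun j => bump_mem _) (fun j => bump_mem _)).trans ?_
    calc ∑ j ∈ Finset.univ.erase i, |bump (x j / R) - bump (y j / R)|
        ≤ ∑ j ∈ Finset.univ.erase i, L * (‖x - y‖ / R) := by
          refine Finset.sum_le_sum fun j _ => (hbump _ _).trans ?_
          rw [← sub_div, abs_div, abs_of_pos hR]
          gcongr
          simpa using PiLp.norm_apply_le (x - y) j
      _ ≤ ∑ j : Fin n, L * (‖x - y‖ / R) :=
          Finset.sum_le_sum_of_subset_of_nonneg (Finset.erase_subset _ _)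
            fun _ _ _ => by positivity
      _ = ‖x - y‖ * (n * L / R) := by
          rw [Finset.sum_const, Finset.card_univ, Fintype.card_fin, nsmul_eq_mul]; ring

/-- Indicator function of the box containing the support of `transCutoff i R`. -/
noncomputable def boxInd (i : Fin n) (R : ℝ) (x : Space n) : ℝ≥0∞ :=
  ∏ j ∈ Finset.univ.erase i, (Set.Icc (-(2 * R)) (2 * R)).indicator 1 (x j)

theorem transCutoff_eq_zero {i : Fin n} {R : ℝ} (hR : 0 < R) {x : Space n}
    (hx : boxInd i R x ≠ 1) : transCutoff i R x = 0 := by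
  have : ∃ j ∈ Finset.univ.erase i, x j ∉ Set.Icc (-(2 * R)) (2 * R) := by
    by_contra! h
    exact hx (Finset.prod_eq_one fun j hj => Set.indicator_of_mem (h j hj) _)
  obtain ⟨j, hj, hxj⟩ := this
  refine Finset.prod_eq_zero hj (bump_eq_zero ?_)
  rw [abs_div, abs_of_pos hR, le_div_iff₀ hR]
  by_contra! h
  exact hxj (abs_le.1 h.le)

theorem enorm_transCutoff_sub_rpow_le (hp : 0 < p) (i : Fin n) {L : ℝ} (hL : 0 < L)
    (hbump : ∀ s t, |bump s - bump t| ≤ L * |s - t|) {R : ℝ} (hR : 0 < R) (x y : Space n) :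
    ‖transCutoff i R x - transCutoff i R y‖ₑ ^ p ≤
      ENNReal.ofReal (min 1 (‖x - y‖ * (n * L / R))) ^ p * (boxInd i R x + boxInd i R y) := by
  have h := abs_transCutoff_sub_le i hL hbump hR x y
  have h' : ‖transCutoff i R x - transCutoff i R y‖ₑ ^ p ≤
      ENNReal.ofReal (min 1 (‖x - y‖ * (n * L / R))) ^ p := by
    gcongr
    rw [← ofReal_norm, Real.norm_eq_abs]
    exact ENNReal.ofReal_le_ofReal h
  by_cases hx : boxInd i R x = 1
  · exact h'.trans (le_mul_of_one_le_right' (by rw [hx]; exact le_self_add))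
  by_cases hy : boxInd i R y = 1
  · exact h'.trans (le_mul_of_one_le_right' (by rw [hy]; exact le_add_self))
  · simp [transCutoff_eq_zero hR hx, transCutoff_eq_zero hR hy, hp]

/-- The integral of the `p`-th power of the one-dimensional cutoff at scale `R`. -/
noncomputable def cutoffMass (p R : ℝ) : ℝ≥0∞ := ∫⁻ t, ‖bump (t / R)‖ₑ ^ p

theorem enorm_transCutoff_rpow (hp : 0 ≤ p) (i : Fin n) (R : ℝ) (x : Space n) :
    ‖transCutoff i R x‖ₑ ^ p = ∏ j ∈ Finset.univ.erase i, ‖bump (x j / R)‖ₑ ^ p := by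
  rw [ENNReal.prod_rpow_of_nonneg hp, transCutoff]
  congr 1
  exact map_prod (⟨⟨enorm, by simp⟩, fun a b => enorm_mul a b⟩ : ℝ →* ℝ≥0∞) _ _

/-- Both bounds are of order `R`, so box volumes and cutoff masses are comparable with constants
independent of `R`. -/
theorem le_cutoffMass (hp : 0 < p) {R : ℝ} (hR : 0 < R) :
    ENNReal.ofReal (2 * R) ≤ cutoffMass p R ∧ cutoffMass p R ≤ ENNReal.ofReal (4 * R) := by
  constructor
  · have : ENNReal.ofReal (2 * R) = ∫⁻ t, (Set.Icc (-R) R).indicator 1 t := by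
      rw [lintegral_indicator_one measurableSet_Icc, Real.volume_Icc]; congr 1; ring
    rw [this]
    refine lintegral_mono fun t => ?_
    by_cases ht : t ∈ Set.Icc (-R) R
    · rw [Set.indicator_of_mem ht,
        bump_eq_one (by rw [abs_div, abs_of_pos hR, div_le_one hR]; exact abs_le.2 ht)]
      simp
    · simp [ht]
  · have : ENNReal.ofReal (4 * R) = ∫⁻ t, (Set.Icc (-(2 * R)) (2 * R)).indicator 1 t := by
      rw [lintegral_indicator_one measurableSet_Icc, Real.volume_Icc]; congr 1; ring
    rw [this]
    refine lintegral_mono fun t => ?_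
    by_cases ht : t ∈ Set.Icc (-(2 * R)) (2 * R)
    · rw [Set.indicator_of_mem ht, Pi.one_apply, ← ofReal_norm, Real.norm_of_nonneg (bump_mem _).1]
      refine ENNReal.rpow_le_one ?_ hp.le
      rw [← ENNReal.ofReal_one]
      exact ENNReal.ofReal_le_ofReal (bump_mem _).2
    · rw [bump_eq_zero]
      · simp [hp]
      · rw [abs_div, abs_of_pos hR, le_div_iff₀ hR]
        by_contra! h
        exact ht (abs_le.1 h.le)

/-- Near `0` the integrand is `t^(p-1-α)`, integrable because `α < p`; at infinity `α > 0` suffices.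
-/
theorem lintegral_kernel_min_ne_top (hα : 0 < α) (hαp : α < p) :
    ∫⁻ t in Set.Ioi (0 : ℝ), ENNReal.ofReal (t ^ (-(1 + α))) * ENNReal.ofReal (min 1 |t|) ^ p
      ≠ ∞ := by
  rw [← Set.Ioc_union_Ioi_eq_Ioi (zero_le_one (α := ℝ))]
  refine ne_top_of_le_ne_top (ENNReal.add_ne_top.2 ⟨?_, ?_⟩) (lintegral_union_le _ _ _)
  · have h := intervalIntegral.intervalIntegrable_rpow' (a := 0) (b := 1) (r := p - (1 + α))
      (by linarith)
    have h := ((intervalIntegrable_iff_integrableOn_Ioc_of_le zero_le_one).1 h).lintegral_lt_top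
    refine ne_top_of_le_ne_top h.ne (setLIntegral_mono' measurableSet_Ioc fun t ht => ?_)
    have ht0 : 0 < t := ht.1
    rw [ENNReal.ofReal_rpow_of_nonneg (by positivity) (by linarith),
      ← ENNReal.ofReal_mul (by positivity), Real.rpow_sub ht0, abs_of_pos ht0, min_eq_right ht.2,
      Real.rpow_neg ht0.le]
    apply ENNReal.ofReal_le_ofReal
    apply le_of_eq
    field_simp
  · have h := (integrableOn_Ioi_rpow_of_lt (a := -(1 + α)) (by linarith)
      one_pos).lintegral_lt_top
    refine ne_top_of_le_ne_top h.ne (setLIntegral_mono' measurableSet_Ioi fun t ht => ?_)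
    refine mul_le_of_le_one_right' (ENNReal.rpow_le_one ?_ (by linarith))
    rw [← ENNReal.ofReal_one]
    exact ENNReal.ofReal_le_ofReal (min_le_left _ _)

end FracHardy

/-! ### Energy of product functions on the half-space. -/

namespace FracHardy

variable {p α : ℝ} {n : ℕ}

/-- The function `g(xᵢ)` cut off at scale `R` in the remaining coordinates. -/
noncomputable def stripFun (i : Fin n) (g : ℝ → ℝ) (R : ℝ) (x : Space n) : ℝ :=
  g (x i) * transCutoff i R x

theorem measurable_transCutoff (i : Fin n) (R : ℝ) : Measurable (transCutoff i R) :=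
  (contDiff_transCutoff i R (m := 0)).continuous.measurable

theorem measurableSet_halfSpace (i : Fin n) : MeasurableSet {x : Space n | 0 < x i} :=
  measurableSet_lt measurable_const (by fun_prop)

theorem contDiff_stripFun (i : Fin n) {g : ℝ → ℝ} {m : ℕ∞} (hg : ContDiff ℝ m g) (R : ℝ) :
    ContDiff ℝ m (stripFun i g R) :=
  (hg.comp (by fun_prop)).mul (contDiff_transCutoff i R)

theorem hasCompactSupport_stripFun (i : Fin n) {g : ℝ → ℝ} (hg : HasCompactSupport g) {R : ℝ}
    (hR : 0 < R) : HasCompactSupport (stripFun i g R) := by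
  obtain ⟨B, hB⟩ := hg.isCompact.isBounded.exists_norm_le
  have hK : IsCompact ((WithLp.toLp 2) '' (Set.univ.pi fun _ : Fin n =>
      Set.Icc (-(max B (2 * R))) (max B (2 * R)))) :=
    (isCompact_univ_pi fun _ => isCompact_Icc).image (PiLp.continuous_toLp 2 _)
  refine HasCompactSupport.of_support_subset_isCompact hK fun x hx => ?_
  refine ⟨x.ofLp, fun j _ => abs_le.1 ?_, rfl⟩
  have hx1 : g (x i) ≠ 0 := left_ne_zero_of_mul hx
  have hx2 : transCutoff i R x ≠ 0 := right_ne_zero_of_mul hx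
  by_cases hj : j = i
  · subst hj
    exact (hB _ (subset_tsupport g hx1)).trans (le_max_left _ _)
  · have := Finset.prod_ne_zero_iff.1 hx2 j (Finset.mem_erase.2 ⟨hj, Finset.mem_univ j⟩)
    refine le_trans ?_ (le_max_right _ _)
    by_contra! h
    refine this (bump_eq_zero ?_)
    rw [abs_div, abs_of_pos hR, le_div_iff₀ hR]
    exact h.le

theorem tsupport_stripFun_subset (i : Fin n) {g : ℝ → ℝ} (hg : tsupport g ⊆ Set.Ioi 0) (R : ℝ) :
    tsupport (stripFun i g R) ⊆ {x | 0 < x i} := by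
  refine (tsupport_mul_subset_left (f := fun x : Space n => g (x i))).trans ?_
  exact (tsupport_comp_subset_preimage g (f := fun x : Space n => x i) (by fun_prop)).trans
    (Set.preimage_mono hg)

theorem lintegral_stripFun (hp : 0 < p) (i : Fin n) {g : ℝ → ℝ} (hg : Measurable g) (R : ℝ) :
    ∫⁻ x in {x : Space n | 0 < x i}, ‖stripFun i g R x‖ₑ ^ p * ENNReal.ofReal ((x i) ^ (-α)) =
      (∫⁻ s in Set.Ioi 0, ENNReal.ofReal (s ^ (-α)) * ‖g s‖ₑ ^ p) * cutoffMass p R ^ (n - 1) := by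
  have h : ∀ x : Space n, {x : Space n | 0 < x i}.indicator
      (fun x => ‖stripFun i g R x‖ₑ ^ p * ENNReal.ofReal ((x i) ^ (-α))) x =
      (Set.Ioi (0 : ℝ)).indicator (fun s => ENNReal.ofReal (s ^ (-α)) * ‖g s‖ₑ ^ p) (x i) *
        ∏ j ∈ Finset.univ.erase i, (fun t => ‖bump (t / R)‖ₑ ^ p) (x j) := by
    intro x
    by_cases hx : 0 < x i
    · rw [Set.indicator_of_mem (by exact hx), Set.indicator_of_mem (by exact hx),
        ← enorm_transCutoff_rpow hp.le, stripFun, enorm_mul, ENNReal.mul_rpow_of_nonneg _ _ hp.le]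
      ring
    · rw [Set.indicator_of_notMem (by exact hx), Set.indicator_of_notMem (by exact hx), zero_mul]
  have hb : Measurable fun t : ℝ => ‖bump (t / R)‖ₑ ^ p := by
    have := bump.continuous.measurable
    fun_prop
  rw [← lintegral_indicator (measurableSet_halfSpace i), lintegral_congr h,
    lintegral_coord_mul_prod i (Measurable.indicator (by fun_prop) measurableSet_Ioi) hb,
    lintegral_indicator measurableSet_Ioi]
  rfl

/-- A step `t w` shifts the `i`-th coordinate by `t * w i`, while the transverse cutoff, evaluated
at one endpoint only, integrates out. The remaining function `K` of the shift is even, so the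
scaling of the kernel applies. -/
theorem lintegral_coord_difference (hp : 0 < p) (hα : 0 < α) [NeZero n] (i : Fin n) {g : ℝ → ℝ}
    (hg : Measurable g) (R : ℝ) :
    ∫⁻ z, ({x : Space n | 0 < x i} ×ˢ {x : Space n | 0 < x i}).indicator
        (fun z => (‖g (z.1 i) - g (z.2 i)‖ₑ * ‖transCutoff i R z.1‖ₑ) ^ p) z /
          ‖z.1 - z.2‖ₑ ^ ((n : ℝ) + α) ∂((volume : Measure (Space n)).prod volume) =
      (∫⁻ w, ENNReal.ofReal (|(w : Space n) i| ^ α) ∂surfaceMeasure n) *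
        halfEnergy p α (Set.Ioi 0) g * cutoffMass p R ^ (n - 1) := by
  have hΦ := measurable_transCutoff i R
  have hH := measurableSet_halfSpace i
  have hb : Measurable fun t : ℝ => ‖bump (t / R)‖ₑ ^ p := by
    have := bump.continuous.measurable
    fun_prop
  set D : ℝ × ℝ → ℝ≥0∞ := (Set.Ioi (0 : ℝ) ×ˢ Set.Ioi (0 : ℝ)).indicator
    (fun z => ‖g z.1 - g z.2‖ₑ ^ p) with hD
  have hDm : Measurable D :=
    Measurable.indicator (by fun_prop) (measurableSet_Ioi.prod measurableSet_Ioi)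
  have hDsymm : ∀ s t, D (s, t) = D (t, s) := by
    intro s t
    by_cases hs : 0 < s <;> by_cases ht : 0 < t <;> simp [hD, hs, ht]
    rw [← enorm_neg, neg_sub]
  set K : ℝ → ℝ≥0∞ := fun τ => ∫⁻ s, D (s, s + τ) with hK
  have hKneg : ∀ τ, K (-τ) = K τ := by
    intro τ
    simp only [hK]
    rw [← lintegral_add_right_eq_self _ τ]
    simp only [add_neg_cancel_right]
    exact lintegral_congr fun s => hDsymm _ _
  have hK0 : K 0 = 0 := by
    simp only [hK, hD, add_zero]
    rw [lintegral_eq_zero_iff' (by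
      exact (hDm.comp (f := fun s : ℝ => (s, s)) (by fun_prop)).aemeasurable)]
    refine Filter.Eventually.of_forall fun s => ?_
    simp [Set.indicator, hp]
  have hKm : Measurable K := by
    have : Measurable fun z : ℝ × ℝ => D (z.2, z.2 + z.1) := hDm.comp (by fun_prop)
    exact this.lintegral_prod_right'
  rw [lintegral_kernel_polar (Measurable.indicator (by fun_prop) (hH.prod hH))]
  have h1 : ∀ (w : Metric.sphere (0 : Space n) 1) (t : ℝ),
      ∫⁻ x, ({x : Space n | 0 < x i} ×ˢ {x : Space n | 0 < x i}).indicator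
        (fun z => (‖g (z.1 i) - g (z.2 i)‖ₑ * ‖transCutoff i R z.1‖ₑ) ^ p)
          (x, x + t • (w : Space n)) = K (t * (w : Space n) i) * cutoffMass p R ^ (n - 1) := by
    intro w t
    have h2 : ∀ x : Space n, ({x : Space n | 0 < x i} ×ˢ {x : Space n | 0 < x i}).indicator
        (fun z => (‖g (z.1 i) - g (z.2 i)‖ₑ * ‖transCutoff i R z.1‖ₑ) ^ p)
          (x, x + t • (w : Space n)) = (fun s => D (s, s + t * (w : Space n) i)) (x i) *
            ∏ j ∈ Finset.univ.erase i, (fun t => ‖bump (t / R)‖ₑ ^ p) (x j) := by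
      intro x
      rw [← enorm_transCutoff_rpow hp.le]
      by_cases hx : 0 < x i ∧ 0 < x i + t * (w : Space n) i
      · rw [Set.indicator_of_mem (by simpa using hx)]
        simp only [hD]
        rw [Set.indicator_of_mem (by simpa using hx), ENNReal.mul_rpow_of_nonneg _ _ hp.le]
        simp
      · rw [Set.indicator_of_notMem (by simpa using hx)]
        simp only [hD]
        rw [Set.indicator_of_notMem (by simpa using hx), zero_mul]
    rw [lintegral_congr h2, lintegral_coord_mul_prod i
      (a := fun s => D (s, s + t * (w : Space n) i)) (hDm.comp (by fun_prop)) hb]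
    rfl
  have h3 : ∀ w : Metric.sphere (0 : Space n) 1, (∫⁻ t in Set.Ioi (0 : ℝ),
      ENNReal.ofReal (t ^ (-(1 + α))) * (K (t * (w : Space n) i) * cutoffMass p R ^ (n - 1))) =
      ENNReal.ofReal (|(w : Space n) i| ^ α) * (halfEnergy p α (Set.Ioi 0) g *
        cutoffMass p R ^ (n - 1)) := by
    intro w
    simp only [← mul_assoc]
    rw [lintegral_mul_const _ (by fun_prop), lintegral_kernel_comp_mul hα hKneg hK0,
      halfEnergy_eq_translation measurableSet_Ioi hg]
  simp only [h1, h3]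
  rw [lintegral_mul_const _ (by fun_prop), mul_assoc]

theorem lintegral_boxInd (i : Fin n) (R : ℝ) {a : ℝ → ℝ≥0∞} (ha : Measurable a) :
    ∫⁻ x : Space n, a (x i) * boxInd i R x =
      (∫⁻ s, a s) * ENNReal.ofReal (4 * R) ^ (n - 1) := by
  have := lintegral_coord_mul_prod i ha (b := (Set.Icc (-(2 * R)) (2 * R)).indicator 1)
    (measurable_one.indicator measurableSet_Icc)
  rw [lintegral_indicator_one measurableSet_Icc, Real.volume_Icc] at this
  rw [show 4 * R = 2 * R - -(2 * R) by ring]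
  exact this

theorem measurable_boxInd (i : Fin n) (R : ℝ) : Measurable (boxInd i R) :=
  Finset.measurable_fun_prod _ fun j _ =>
    (measurable_one.indicator measurableSet_Icc).comp (by fun_prop)

/-- The cutoff varies on scale `R`, so its fractional energy per unit of transverse volume is of
order `R^(-α)`, negligible against the main term as `R` grows. -/
theorem lintegral_cutoff_difference_le (hp : 0 < p) (hα : 0 < α) [NeZero n] (i : Fin n)
    {g : ℝ → ℝ} (hg : Measurable g) {L : ℝ} (hL : 0 < L)
    (hbump : ∀ s t, |bump s - bump t| ≤ L * |s - t|) {R : ℝ} (hR : 0 < R) :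
    ∫⁻ z, ({x : Space n | 0 < x i} ×ˢ {x : Space n | 0 < x i}).indicator
        (fun z => (‖g (z.2 i)‖ₑ * ‖transCutoff i R z.1 - transCutoff i R z.2‖ₑ) ^ p) z /
          ‖z.1 - z.2‖ₑ ^ ((n : ℝ) + α) ∂((volume : Measure (Space n)).prod volume) ≤
      (2 * (∫⁻ s, ‖g s‖ₑ ^ p) * surfaceMeasure n Set.univ * (∫⁻ t in Set.Ioi (0 : ℝ),
        ENNReal.ofReal (t ^ (-(1 + α))) * ENNReal.ofReal (min 1 |t|) ^ p)) *
        ENNReal.ofReal ((n * L / R) ^ α) * ENNReal.ofReal (4 * R) ^ (n - 1) := by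
  have hΦ := measurable_transCutoff i R
  have hH := measurableSet_halfSpace i
  have hn : (0 : ℝ) < n := by exact_mod_cast NeZero.pos n
  set c := n * L / R with hc
  have hc0 : 0 < c := by positivity
  rw [lintegral_kernel_polar (Measurable.indicator (by fun_prop) (hH.prod hH))]
  set Gp := ∫⁻ s, ‖g s‖ₑ ^ p
  set Q := ENNReal.ofReal (4 * R) ^ (n - 1)
  have h1 : ∀ (w : Metric.sphere (0 : Space n) 1), ∀ t ∈ Set.Ioi (0 : ℝ),
      ENNReal.ofReal (t ^ (-(1 + α))) *
      ∫⁻ x, ({x : Space n | 0 < x i} ×ˢ {x : Space n | 0 < x i}).indicator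
        (fun z => (‖g (z.2 i)‖ₑ * ‖transCutoff i R z.1 - transCutoff i R z.2‖ₑ) ^ p)
          (x, x + t • (w : Space n)) ≤
      ENNReal.ofReal (t ^ (-(1 + α))) * ENNReal.ofReal (min 1 |t * c|) ^ p * (2 * Gp * Q) := by
    intro w t ht
    have ht : 0 < t := ht
    rw [mul_assoc]
    gcongr
    have hw : ‖(w : Space n)‖ = 1 := by simp
    have hga : Measurable fun s => ‖g s‖ₑ ^ p := by fun_prop
    have hga' : Measurable fun s => ‖g (s + t * (w : Space n) i)‖ₑ ^ p := by fun_prop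
    have hbox := measurable_boxInd i R
    have h2 : ∀ x : Space n, ({x : Space n | 0 < x i} ×ˢ {x : Space n | 0 < x i}).indicator
        (fun z => (‖g (z.2 i)‖ₑ * ‖transCutoff i R z.1 - transCutoff i R z.2‖ₑ) ^ p)
          (x, x + t • (w : Space n)) ≤ ENNReal.ofReal (min 1 |t * c|) ^ p *
          (‖g (x i + t * (w : Space n) i)‖ₑ ^ p * boxInd i R x +
            ‖g ((x + t • (w : Space n)) i)‖ₑ ^ p * boxInd i R (x + t • (w : Space n))) := by
      intro x
      refine (Set.indicator_le_self _ _ _).trans ?_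
      have h3 := enorm_transCutoff_sub_rpow_le hp i hL hbump hR x (x + t • (w : Space n))
      rw [sub_add_cancel_left, norm_neg, norm_smul, hw, mul_one, Real.norm_of_nonneg ht.le,
        ← hc] at h3
      simp only []
      rw [ENNReal.mul_rpow_of_nonneg _ _ hp.le, abs_of_pos (mul_pos ht hc0)]
      refine (mul_le_mul_right h3 _).trans_eq ?_
      simp only [PiLp.add_apply, PiLp.smul_apply, smul_eq_mul]
      ring
    refine (lintegral_mono h2).trans_eq ?_
    rw [lintegral_const_mul _ (by fun_prop), lintegral_add_left (by fun_prop),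
      lintegral_boxInd i R hga',
      lintegral_add_right_eq_self (fun x : Space n => ‖g (x i)‖ₑ ^ p * boxInd i R x),
      lintegral_boxInd i R hga,
      lintegral_add_right_eq_self (fun s : ℝ => ‖g s‖ₑ ^ p)]
    ring
  calc _ ≤ ∫⁻ _ : Metric.sphere (0 : Space n) 1, (∫⁻ t in Set.Ioi (0 : ℝ),
        ENNReal.ofReal (t ^ (-(1 + α))) * ENNReal.ofReal (min 1 |t * c|) ^ p * (2 * Gp * Q))
          ∂surfaceMeasure n :=
        lintegral_mono fun w => setLIntegral_mono' measurableSet_Ioi (h1 w)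
    _ = _ := by
        rw [lintegral_mul_const _ (by fun_prop), lintegral_kernel_comp_mul hα
          (K := fun t => ENNReal.ofReal (min 1 |t|) ^ p) (by simp) (by simp [hp]),
          abs_of_pos hc0, lintegral_const]
        ring

end FracHardy

/-! ### From the half-space to the half-line, and the virtual ground state. -/

namespace FracHardy

variable {p α : ℝ} {n : ℕ}

theorem lintegral_enorm_rpow_ne_top (hp : 0 < p) {g : ℝ → ℝ} (hg : Continuous g)
    (hc : HasCompactSupport g) : ∫⁻ s, ‖g s‖ₑ ^ p ≠ ∞ := by
  obtain ⟨C, hC⟩ := hg.bounded_above_of_compact_support hc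
  refine ne_top_of_le_ne_top (b := ∫⁻ s in tsupport g, ENNReal.ofReal C ^ p) ?_ ?_
  · rw [setLIntegral_const]
    exact ENNReal.mul_ne_top (by simp [hp.le]) hc.isCompact.measure_lt_top.ne
  · rw [← lintegral_indicator (isClosed_tsupport g).measurableSet]
    refine lintegral_mono fun s => ?_
    by_cases hs : s ∈ tsupport g
    · rw [Set.indicator_of_mem hs, ← ofReal_norm]
      gcongr
      exact hC s
    · simp [image_eq_zero_of_notMem_tsupport hs, hp]

/-- A Hardy inequality on the half-space implies one on the half-line. -/
theorem halfLine_of_halfSpace [NeZero n] (hp : 1 < p) (hα : 0 < α) (hαp : α < p) (i : Fin n)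
    {c : ℝ≥0∞}
    (h : ∀ F : Space n → ℝ, ContDiff ℝ (⊤ : ℕ∞) F → HasCompactSupport F →
      tsupport F ⊆ {x | 0 < x i} →
      c * ∫⁻ x in {x : Space n | 0 < x i}, ‖F x‖ₑ ^ p * ENNReal.ofReal ((x i) ^ (-α)) ≤
        energy p α {x | 0 < x i} F)
    {g : ℝ → ℝ} (hg : ContDiff ℝ (⊤ : ℕ∞) g) (hc : HasCompactSupport g)
    (hs : tsupport g ⊆ Set.Ioi 0) :
    c * ∫⁻ s in Set.Ioi 0, ENNReal.ofReal (s ^ (-α)) * ‖g s‖ₑ ^ p ≤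
      (∫⁻ w, ENNReal.ofReal (|(w : Space n) i| ^ α) ∂surfaceMeasure n) *
        halfEnergy p α (Set.Ioi 0) g := by
  have hp0 : 0 < p := by linarith
  obtain ⟨L, hL, hbump⟩ := exists_bump_lipschitz
  have hn : (0 : ℝ) < n := by exact_mod_cast NeZero.pos n
  have hgm := hg.continuous.measurable
  set N := ∫⁻ s in Set.Ioi 0, ENNReal.ofReal (s ^ (-α)) * ‖g s‖ₑ ^ p
  set A := (∫⁻ w, ENNReal.ofReal (|(w : Space n) i| ^ α) ∂surfaceMeasure n) *
    halfEnergy p α (Set.Ioi 0) g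
  -- The factor `2^(n-1)` absorbs the passage from the box volume `(4R)^(n-1)` to the cutoff mass,
  -- which is at least `(2R)^(n-1)`.
  set D := 2 * (∫⁻ s, ‖g s‖ₑ ^ p) * surfaceMeasure n Set.univ * (∫⁻ t in Set.Ioi (0 : ℝ),
        ENNReal.ofReal (t ^ (-(1 + α))) * ENNReal.ofReal (min 1 |t|) ^ p) * 2 ^ (n - 1) with hD
  have hDtop : D ≠ ∞ := by
    refine ENNReal.mul_ne_top (ENNReal.mul_ne_top (ENNReal.mul_ne_top (ENNReal.mul_ne_top
      ENNReal.ofNat_ne_top (lintegral_enorm_rpow_ne_top hp0 hg.continuous hc))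
      (measure_ne_top _ _)) (lintegral_kernel_min_ne_top hα hαp)) (by simp)
  have key : ∀ R : ℝ, 0 < R →
      c * N ≤ (A ^ (1 / p) + (D * ENNReal.ofReal ((n * L / R) ^ α)) ^ (1 / p)) ^ p := by
    intro R hR
    obtain ⟨hM1, hM2⟩ := le_cutoffMass hp0 hR
    set M := cutoffMass p R ^ (n - 1) with hM
    have hM0 : M ≠ 0 := pow_ne_zero _ (ne_of_gt (lt_of_lt_of_le (by simpa using hR) hM1))
    have hMtop : M ≠ ∞ := ENNReal.pow_ne_top (ne_top_of_le_ne_top ENNReal.ofReal_ne_top hM2)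
    have h1 := h (stripFun i g R) (contDiff_stripFun i hg R) (hasCompactSupport_stripFun i hc hR)
      (tsupport_stripFun_subset i hs R)
    rw [lintegral_stripFun hp0 i hgm] at h1
    have hΦ := measurable_transCutoff i R
    -- With `φ` the transverse cutoff, the difference of `g φ` at two points splits as `(g(x) -
    -- g(y)) φ(x) + g(y) (φ(x) - φ(y))`.
    have h2 := energy_le_of_enorm_sub_le (p := p) (α := α) hp (measurableSet_halfSpace i)
      (f := stripFun i g R)
      (a := fun z => ‖g (z.1 i) - g (z.2 i)‖ₑ * ‖transCutoff i R z.1‖ₑ)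
      (b := fun z => ‖g (z.2 i)‖ₑ * ‖transCutoff i R z.1 - transCutoff i R z.2‖ₑ)
      (by fun_prop) (by fun_prop) (fun z => by
        rw [← enorm_mul, ← enorm_mul]
        refine le_trans (le_of_eq ?_) (enorm_add_le _ _)
        simp only [stripFun]
        congr 1
        ring)
    rw [lintegral_coord_difference hp0 hα i hgm] at h2
    have h3 := lintegral_cutoff_difference_le (p := p) (α := α) hp0 hα i hgm hL hbump hR
    have h4 : ENNReal.ofReal (4 * R) ^ (n - 1) ≤ 2 ^ (n - 1) * M := by
      rw [hM, ← mul_pow]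
      gcongr
      refine le_trans (le_of_eq ?_) (mul_le_mul_right hM1 2)
      rw [← ENNReal.ofReal_ofNat, ← ENNReal.ofReal_mul zero_le_two]
      congr 1; ring
    have h5 : c * N * M ≤ (A ^ (1 / p) + (D * ENNReal.ofReal ((n * L / R) ^ α)) ^ (1 / p)) ^ p
        * M := by
      calc c * N * M = c * (N * M) := mul_assoc _ _ _
        _ ≤ ((A * M) ^ (1 / p) + (D * ENNReal.ofReal ((n * L / R) ^ α) * M) ^ (1 / p)) ^ p := by
          refine (h1.trans h2).trans ?_
          gcongr
          refine h3.trans ((mul_le_mul_right h4 _).trans_eq ?_)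
          rw [hD]; ring
        _ = _ := by
          rw [ENNReal.mul_rpow_of_nonneg _ M (by positivity),
            ENNReal.mul_rpow_of_nonneg _ M (by positivity), ← add_mul,
            ENNReal.mul_rpow_of_nonneg _ _ hp0.le, ← ENNReal.rpow_mul M,
            one_div_mul_cancel hp0.ne', ENNReal.rpow_one]
    exact (ENNReal.mul_le_mul_iff_left hM0 hMtop).1 h5
  have hlim : Filter.Tendsto (fun R : ℝ =>
      (A ^ (1 / p) + (D * ENNReal.ofReal ((n * L / R) ^ α)) ^ (1 / p)) ^ p) Filter.atTop
      (nhds ((A ^ (1 / p) + (D * ENNReal.ofReal 0) ^ (1 / p)) ^ p)) := by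
    have h1 : Filter.Tendsto (fun R : ℝ => (n * L / R) ^ α) Filter.atTop (nhds 0) := by
      have := (tendsto_const_nhds (x := n * L)).div_atTop Filter.tendsto_id
      have := this.rpow_const (p := α) (Or.inr hα.le)
      rwa [Real.zero_rpow hα.ne'] at this
    refine (ENNReal.continuous_rpow_const.tendsto _).comp (Filter.Tendsto.const_add _ ?_)
    refine (ENNReal.continuous_rpow_const.tendsto _).comp ?_
    exact ENNReal.Tendsto.const_mul (ENNReal.tendsto_ofReal h1) (Or.inr hDtop)
  have h0 := ge_of_tendsto hlim ((Filter.eventually_gt_atTop 0).mono key)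
  rwa [ENNReal.ofReal_zero, mul_zero, ENNReal.zero_rpow_of_pos (by positivity), add_zero,
    ← ENNReal.rpow_mul, one_div_mul_cancel hp0.ne', ENNReal.rpow_one] at h0

/-- A logarithmic cutoff of the virtual ground state `s ^ β` on the half-line. -/
noncomputable def groundFun (β T : ℝ) : ℝ → ℝ :=
  (Set.Ioi (0 : ℝ)).indicator fun s => s ^ β * bump (Real.log s / T)

theorem bump_log_eq_zero {T s : ℝ} (hT : 0 < T) (hs0 : 0 < s)
    (hs : s ∉ Set.Icc (Real.exp (-(2 * T))) (Real.exp (2 * T))) : bump (Real.log s / T) = 0 := by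
  refine bump_eq_zero ?_
  rw [abs_div, abs_of_pos hT, le_div_iff₀ hT]
  by_contra! h
  rw [abs_lt] at h
  exact hs ⟨((Real.lt_log_iff_exp_lt hs0).1 h.1).le, ((Real.log_lt_iff_lt_exp hs0).1 h.2).le⟩

theorem groundFun_eq_zero {β T s : ℝ} (hT : 0 < T)
    (hs : s ∉ Set.Icc (Real.exp (-(2 * T))) (Real.exp (2 * T))) : groundFun β T s = 0 := by
  by_cases hs0 : 0 < s
  · rw [groundFun, Set.indicator_of_mem (by exact hs0), bump_log_eq_zero hT hs0 hs, mul_zero]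
  · exact Set.indicator_of_notMem hs0 _

theorem tsupport_groundFun_subset (β : ℝ) {T : ℝ} (hT : 0 < T) :
    tsupport (groundFun β T) ⊆ Set.Icc (Real.exp (-(2 * T))) (Real.exp (2 * T)) :=
  closure_minimal (fun s hs => by
    by_contra h
    exact hs (groundFun_eq_zero hT h)) isClosed_Icc

theorem contDiff_groundFun (β : ℝ) {T : ℝ} (hT : 0 < T) {m : ℕ∞} :
    ContDiff ℝ m (groundFun β T) := by
  rw [contDiff_iff_contDiffAt]
  intro s
  by_cases hs : 0 < s
  · have h1 : ContDiffAt ℝ m (fun s : ℝ => s ^ β * bump (Real.log s / T)) s := by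
      refine (Real.contDiffAt_rpow_const_of_ne hs.ne').mul ?_
      exact bump.contDiffAt.comp s ((Real.contDiffAt_log.2 hs.ne').div_const T)
    refine h1.congr_of_eventuallyEq ?_
    filter_upwards [lt_mem_nhds hs] with t ht
    exact Set.indicator_of_mem ht _
  · refine contDiffAt_const (c := (0 : ℝ)).congr_of_eventuallyEq ?_
    filter_upwards [gt_mem_nhds ((not_lt.1 hs).trans_lt (Real.exp_pos (-(2 * T))))] with t ht
    exact groundFun_eq_zero hT fun h => absurd h.1 (not_le.2 ht)

theorem lintegral_inv_Icc_exp {T : ℝ} (hT : 0 < T) :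
    ∫⁻ s in Set.Ioi (0 : ℝ), ENNReal.ofReal s⁻¹ *
      (Set.Icc (Real.exp (-T)) (Real.exp T)).indicator 1 s = ENNReal.ofReal (2 * T) := by
  have hle : Real.exp (-T) ≤ Real.exp T := Real.exp_le_exp.2 (by linarith)
  have hsub : Set.Icc (Real.exp (-T)) (Real.exp T) ⊆ Set.Ioi 0 := fun s hs =>
    (Real.exp_pos _).trans_le hs.1
  have h1 : ∀ s, ENNReal.ofReal s⁻¹ * (Set.Icc (Real.exp (-T)) (Real.exp T)).indicator 1 s =
      (Set.Icc (Real.exp (-T)) (Real.exp T)).indicator (fun s => ENNReal.ofReal s⁻¹) s := by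
    intro s
    by_cases hs : s ∈ Set.Icc (Real.exp (-T)) (Real.exp T) <;> simp [hs]
  simp only [h1]
  rw [lintegral_indicator measurableSet_Icc, Measure.restrict_restrict measurableSet_Icc,
    Set.inter_eq_left.2 hsub, ← ofReal_integral_eq_lintegral_ofReal,
    integral_Icc_eq_integral_Ioc, ← intervalIntegral.integral_of_le hle,
    integral_inv_of_pos (Real.exp_pos _) (Real.exp_pos _), ← Real.exp_sub, Real.log_exp]
  · congr 1; ring
  · exact (ContinuousOn.inv₀ continuousOn_id fun s hs => (hsub hs).ne').integrableOn_Icc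
  · filter_upwards [ae_restrict_mem measurableSet_Icc] with s hs
    exact inv_nonneg.2 (hsub hs).le

end FracHardy

/-! ### Sharpness on the half-line and the half-space. -/

namespace FracHardy

variable {p α : ℝ} {n : ℕ}

/-- Indicator function of the interval containing the support of `groundFun β T`. -/
noncomputable def logBoxInd (T : ℝ) : ℝ → ℝ≥0∞ :=
  (Set.Icc (Real.exp (-(2 * T))) (Real.exp (2 * T))).indicator 1

theorem measurable_logBoxInd (T : ℝ) : Measurable (logBoxInd T) :=
  measurable_one.indicator measurableSet_Icc

theorem logBoxInd_rpow (hp : 0 < p) (T s : ℝ) : logBoxInd T s ^ p = logBoxInd T s := by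
  by_cases hs : s ∈ Set.Icc (Real.exp (-(2 * T))) (Real.exp (2 * T)) <;>
    simp [logBoxInd, Set.indicator, hs, hp]

/-- This is `1 - 1/y ≤ log y` at `y = r^β`. It makes the cutoff error proportional to `1 - r^β`, so
that the integral over `r` still yields exactly `hardyInt`. -/
theorem rpow_mul_neg_log_le {β r : ℝ} (hβ : 0 < β) (hr : 0 < r) :
    r ^ β * (-Real.log r) ≤ (1 - r ^ β) / β := by
  have hrβ : 0 < r ^ β := Real.rpow_pos_of_pos hr β
  have h := Real.one_sub_inv_le_log_of_pos hrβ
  rw [Real.log_rpow hr] at h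
  rw [le_div_iff₀ hβ]
  have h2 := mul_le_mul_of_nonneg_left h hrβ.le
  rw [mul_sub, mul_one, mul_inv_cancel₀ hrβ.ne'] at h2
  linarith

theorem enorm_bump_log_sub_le {L : ℝ}
    (hbump : ∀ s t, |bump s - bump t| ≤ L * |s - t|) {T r s : ℝ} (hT : 0 < T)
    (hr : r ∈ Set.Ioo (0 : ℝ) 1) (hs : 0 < s) :
    ‖bump (Real.log s / T) - bump (Real.log (r * s) / T)‖ₑ ≤
      ENNReal.ofReal (L / T * (-Real.log r)) * (logBoxInd T s + logBoxInd T (r * s)) := by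
  have hrs : 0 < r * s := mul_pos hr.1 hs
  have h : ‖bump (Real.log s / T) - bump (Real.log (r * s) / T)‖ₑ ≤
      ENNReal.ofReal (L / T * (-Real.log r)) := by
    rw [← ofReal_norm, Real.norm_eq_abs]
    refine ENNReal.ofReal_le_ofReal ((hbump _ _).trans_eq ?_)
    rw [Real.log_mul hr.1.ne' hs.ne', ← sub_div, abs_div, abs_of_pos hT, sub_add_cancel_right,
      abs_of_pos (neg_pos.2 (Real.log_neg hr.1 hr.2))]
    ring
  by_cases h1 : s ∈ Set.Icc (Real.exp (-(2 * T))) (Real.exp (2 * T))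
  · refine h.trans (le_mul_of_one_le_right' ?_)
    rw [logBoxInd, Set.indicator_of_mem h1]
    exact le_self_add
  by_cases h2 : r * s ∈ Set.Icc (Real.exp (-(2 * T))) (Real.exp (2 * T))
  · refine h.trans (le_mul_of_one_le_right' ?_)
    rw [logBoxInd, Set.indicator_of_mem h2]
    exact le_add_self
  · rw [bump_log_eq_zero hT hs h1, bump_log_eq_zero hT hrs h2]
    simp

theorem enorm_groundFun_sub_le {β L : ℝ} (hβ : 0 < β) (hL : 0 < L)
    (hbump : ∀ s t, |bump s - bump t| ≤ L * |s - t|) {T r s : ℝ} (hT : 0 < T)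
    (hr : r ∈ Set.Ioo (0 : ℝ) 1) (hs : 0 < s) :
    ‖groundFun β T s - groundFun β T (r * s)‖ₑ ≤ ENNReal.ofReal (s ^ β) *
      (ENNReal.ofReal (1 - r ^ β) * (‖bump (Real.log s / T)‖ₑ +
        (ENNReal.ofReal (L / (T * β)) * logBoxInd T s +
          ENNReal.ofReal (L / (T * β)) * logBoxInd T (r * s)))) := by
  have hrs : 0 < r * s := mul_pos hr.1 hs
  have hrβ : r ^ β ≤ 1 := Real.rpow_le_one hr.1.le hr.2.le hβ.le
  have hrβ0 : 0 ≤ r ^ β := Real.rpow_nonneg hr.1.le _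
  have h1 : groundFun β T s - groundFun β T (r * s) = s ^ β * ((1 - r ^ β) * bump (Real.log s / T) +
      r ^ β * (bump (Real.log s / T) - bump (Real.log (r * s) / T))) := by
    rw [groundFun, Set.indicator_of_mem (by exact hs), Set.indicator_of_mem (by exact hrs),
      Real.mul_rpow hr.1.le hs.le]
    ring
  have h2 : ‖r ^ β * (bump (Real.log s / T) - bump (Real.log (r * s) / T))‖ₑ ≤
      ENNReal.ofReal (1 - r ^ β) * (ENNReal.ofReal (L / (T * β)) *
        (logBoxInd T s + logBoxInd T (r * s))) := by
    rw [enorm_mul, ← mul_assoc, ← ENNReal.ofReal_mul (by linarith), Real.enorm_of_nonneg hrβ0]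
    refine (mul_le_mul_right (enorm_bump_log_sub_le hbump hT hr hs) _).trans ?_
    rw [← mul_assoc, ← ENNReal.ofReal_mul hrβ0]
    refine mul_le_mul' (ENNReal.ofReal_le_ofReal ?_) le_rfl
    calc r ^ β * (L / T * (-Real.log r)) = L / T * (r ^ β * (-Real.log r)) := by ring
      _ ≤ L / T * ((1 - r ^ β) / β) := by
        gcongr
        exact rpow_mul_neg_log_le hβ hr.1
      _ = _ := by field_simp
  rw [h1, enorm_mul, Real.enorm_of_nonneg (Real.rpow_nonneg hs.le _)]
  gcongr
  refine (enorm_add_le _ _).trans ?_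
  rw [mul_add, ← mul_add (ENNReal.ofReal (L / (T * β))), enorm_mul,
    Real.enorm_of_nonneg (by linarith : 0 ≤ 1 - r ^ β)]
  gcongr

/-- The exponent `(α-1)/p` turns the weight into `ds/s`, the dilation-invariant measure. -/
theorem lintegral_groundFun (hp : 0 < p) (T : ℝ) :
    ∫⁻ s in Set.Ioi 0, ENNReal.ofReal (s ^ (-α)) * ‖groundFun ((α - 1) / p) T s‖ₑ ^ p =
      ∫⁻ s in Set.Ioi 0, ENNReal.ofReal s⁻¹ * ‖bump (Real.log s / T)‖ₑ ^ p := by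
  refine setLIntegral_congr_fun measurableSet_Ioi fun s hs => ?_
  have hs0 : 0 < s := hs
  rw [groundFun, Set.indicator_of_mem hs, enorm_mul, ENNReal.mul_rpow_of_nonneg _ _ hp.le,
    Real.enorm_of_nonneg (by positivity), ENNReal.ofReal_rpow_of_pos (by positivity),
    ← mul_assoc, ← ENNReal.ofReal_mul (by positivity), ← Real.rpow_mul hs0.le,
    ← Real.rpow_add hs0, div_mul_cancel₀ _ hp.ne', show -α + (α - 1) = -1 by ring,
    Real.rpow_neg_one]

theorem lintegral_groundFun_bounds (hp : 0 < p) {T : ℝ} (hT : 0 < T) :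
    ENNReal.ofReal (2 * T) ≤
        ∫⁻ s in Set.Ioi 0, ENNReal.ofReal s⁻¹ * ‖bump (Real.log s / T)‖ₑ ^ p ∧
      ∫⁻ s in Set.Ioi 0, ENNReal.ofReal s⁻¹ * ‖bump (Real.log s / T)‖ₑ ^ p ≤
        ENNReal.ofReal (4 * T) := by
  constructor
  · rw [← lintegral_inv_Icc_exp hT]
    refine setLIntegral_mono' measurableSet_Ioi fun s hs => ?_
    gcongr
    by_cases h : s ∈ Set.Icc (Real.exp (-T)) (Real.exp T)
    · rw [Set.indicator_of_mem h, bump_eq_one]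
      · simp
      · rw [abs_div, abs_of_pos hT, div_le_one hT, abs_le]
        exact ⟨(Real.le_log_iff_exp_le hs).2 h.1, (Real.log_le_iff_le_exp hs).2 h.2⟩
    · simp [h]
  · rw [show 4 * T = 2 * (2 * T) by ring, ← lintegral_inv_Icc_exp (by positivity : 0 < 2 * T)]
    refine setLIntegral_mono' measurableSet_Ioi fun s hs => ?_
    gcongr
    by_cases h : s ∈ Set.Icc (Real.exp (-(2 * T))) (Real.exp (2 * T))
    · rw [Set.indicator_of_mem h, Pi.one_apply, ← ofReal_norm, Real.norm_of_nonneg (bump_mem _).1]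
      refine ENNReal.rpow_le_one ?_ hp.le
      rw [← ENNReal.ofReal_one]
      exact ENNReal.ofReal_le_ofReal (bump_mem _).2
    · rw [bump_log_eq_zero hT hs h]
      simp [hp]

/-- For each `r`, the increment is `s^β (1 - r^β)` times the cutoff plus two errors of size `1/T`
supported on logarithmic boxes. By dilation invariance of `ds/s` both boxes have mass `4T`, and
Minkowski's inequality adds the three norms. -/
theorem halfEnergy_groundFun_le (hp : 1 < p) (hα : 1 < α) {L : ℝ} (hL : 0 < L)
    (hbump : ∀ s t, |bump s - bump t| ≤ L * |s - t|) {T : ℝ} (hT : 0 < T) :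
    halfEnergy p α (Set.Ioi 0) (groundFun ((α - 1) / p) T) ≤ hardyInt p α *
      ((∫⁻ s in Set.Ioi 0, ENNReal.ofReal s⁻¹ * ‖bump (Real.log s / T)‖ₑ ^ p) ^ (1 / p) +
        2 * (ENNReal.ofReal (L / (T * ((α - 1) / p))) * ENNReal.ofReal (4 * T) ^ (1 / p))) ^ p := by
  have hp0 : 0 < p := by linarith
  set β := (α - 1) / p with hβ
  have hβ0 : 0 < β := div_pos (by linarith) hp0
  set d := ENNReal.ofReal (L / (T * β)) with hd
  have hgm : Measurable (groundFun β T) := (contDiff_groundFun β hT (m := 0)).continuous.measurable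
  have hbm := bump.continuous.measurable
  have hqm := measurable_logBoxInd T
  set μ := (volume.restrict (Set.Ioi (0 : ℝ))).withDensity (fun s => ENNReal.ofReal s⁻¹) with hμ
  have hμi : ∀ f : ℝ → ℝ≥0∞, Measurable f →
      ∫⁻ s, f s ∂μ = ∫⁻ s in Set.Ioi 0, ENNReal.ofReal s⁻¹ * f s := fun f hf =>
    lintegral_withDensity_eq_lintegral_mul _ (by fun_prop) hf
  have hq : ∫⁻ s, (d * logBoxInd T s) ^ p ∂μ = d ^ p * ENNReal.ofReal (4 * T) := by
    simp only [ENNReal.mul_rpow_of_nonneg _ _ hp0.le, logBoxInd_rpow hp0]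
    rw [lintegral_const_mul _ hqm, hμi _ hqm, show 4 * T = 2 * (2 * T) by ring,
      ← lintegral_inv_Icc_exp (by positivity : 0 < 2 * T)]
    rfl
  have hqr : ∀ r, 0 < r → ∫⁻ s, (d * logBoxInd T (r * s)) ^ p ∂μ =
      d ^ p * ENNReal.ofReal (4 * T) := by
    intro r hr
    rw [← hq, hμi _ (by fun_prop), hμi _ (by fun_prop), ← setLIntegral_Ioi_comp_mul_left hr
      (fun s => ENNReal.ofReal s⁻¹ * (d * logBoxInd T s) ^ p),
      ← lintegral_const_mul' _ _ ENNReal.ofReal_ne_top]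
    refine lintegral_congr fun s => ?_
    rw [← mul_assoc, ← ENNReal.ofReal_mul hr.le, mul_inv, mul_inv_cancel_left₀ hr.ne']
  have hroot : (d ^ p * ENNReal.ofReal (4 * T)) ^ (1 / p) = d * ENNReal.ofReal (4 * T) ^ (1 / p) := by
    rw [ENNReal.mul_rpow_of_nonneg _ _ (by positivity), ← ENNReal.rpow_mul,
      mul_one_div_cancel hp0.ne', ENNReal.rpow_one]
  rw [halfEnergy_eq_dilation measurableSet_Ioi subset_rfl
    (fun s hs r hr => mul_pos hr.1 hs) hgm, hardyInt, ← lintegral_mul_const _ (by fun_prop)]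
  refine setLIntegral_mono' measurableSet_Ioo fun r hr => ?_
  rw [mul_assoc]
  gcongr
  calc ∫⁻ s in Set.Ioi 0, ENNReal.ofReal (s ^ (-α)) * ‖groundFun β T s - groundFun β T (r * s)‖ₑ ^ p
      ≤ ∫⁻ s in Set.Ioi 0, ENNReal.ofReal (1 - r ^ β) ^ p * (ENNReal.ofReal s⁻¹ *
          (‖bump (Real.log s / T)‖ₑ + (d * logBoxInd T s + d * logBoxInd T (r * s))) ^ p) := by
        refine setLIntegral_mono' measurableSet_Ioi fun s hs => ?_
        have hs0 : 0 < s := hs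
        refine (mul_le_mul_right (ENNReal.rpow_le_rpow
          (enorm_groundFun_sub_le hβ0 hL hbump hT hr hs0) hp0.le) _).trans_eq ?_
        rw [ENNReal.mul_rpow_of_nonneg _ _ hp0.le, ENNReal.mul_rpow_of_nonneg _ _ hp0.le,
          ENNReal.ofReal_rpow_of_pos (by positivity), ← mul_assoc,
          ← ENNReal.ofReal_mul (by positivity), ← Real.rpow_mul hs0.le, ← Real.rpow_add hs0, hβ,
          div_mul_cancel₀ _ hp0.ne', show -α + (α - 1) = -1 by ring, Real.rpow_neg_one]
        ring
    _ = ENNReal.ofReal (1 - r ^ β) ^ p * ∫⁻ s, ((fun s => ‖bump (Real.log s / T)‖ₑ) +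
          ((fun s => d * logBoxInd T s) + fun s => d * logBoxInd T (r * s))) s ^ p ∂μ := by
        rw [lintegral_const_mul _ (by fun_prop), ← hμi _ (by fun_prop)]
        rfl
    _ ≤ _ := by
        gcongr
        rw [← ENNReal.rpow_le_rpow_iff (z := 1 / p) (by positivity), ← ENNReal.rpow_mul,
          mul_one_div_cancel hp0.ne', ENNReal.rpow_one]
        refine (ENNReal.lintegral_Lp_add_le (by fun_prop) (by fun_prop) hp.le).trans ?_
        rw [hμi _ (by fun_prop)]
        gcongr
        refine (ENNReal.lintegral_Lp_add_le (by fun_prop) (by fun_prop) hp.le).trans_eq ?_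
        rw [hq, hqr r hr.1, hroot, two_mul]

/-- Sharpness on the half-line. -/
theorem le_of_halfLine (hp : 1 < p) (hα : 1 < α) {c S : ℝ≥0∞} (hST : S * hardyInt p α ≠ ∞)
    (h : ∀ g : ℝ → ℝ, ContDiff ℝ (⊤ : ℕ∞) g → HasCompactSupport g → tsupport g ⊆ Set.Ioi 0 →
      c * ∫⁻ s in Set.Ioi 0, ENNReal.ofReal (s ^ (-α)) * ‖g s‖ₑ ^ p ≤
        S * halfEnergy p α (Set.Ioi 0) g) :
    c ≤ S * hardyInt p α := by
  have hp0 : 0 < p := by linarith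
  obtain ⟨L, hL, hbump⟩ := exists_bump_lipschitz
  set β := (α - 1) / p with hβ
  have hβ0 : 0 < β := div_pos (by linarith) hp0
  have key : ∀ T : ℝ, 0 < T →
      c ≤ S * hardyInt p α * (1 + 4 * ENNReal.ofReal (L / (T * β))) ^ p := by
    intro T hT
    have hsub := tsupport_groundFun_subset β hT
    have h1 := h (groundFun β T) (contDiff_groundFun β hT)
      (HasCompactSupport.of_support_subset_isCompact isCompact_Icc ((subset_tsupport _).trans hsub))
      (hsub.trans fun s hs => (Real.exp_pos _).trans_le hs.1)
    obtain ⟨hN1, hN2⟩ := lintegral_groundFun_bounds hp0 hT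
    have h2 := halfEnergy_groundFun_le hp hα hL hbump hT
    rw [lintegral_groundFun hp0] at h1
    set N := ∫⁻ s in Set.Ioi 0, ENNReal.ofReal s⁻¹ * ‖bump (Real.log s / T)‖ₑ ^ p
    have hN0 : N ≠ 0 := ne_of_gt (lt_of_lt_of_le (by simpa using hT) hN1)
    have hNT : N ≠ ∞ := ne_top_of_le_ne_top ENNReal.ofReal_ne_top hN2
    -- Since `2T ≤ N`, the errors are comparable to the main norm, with relative size tending to `0`
    -- like `1/T`.
    have h3 : ENNReal.ofReal (4 * T) ^ (1 / p) ≤ 2 * N ^ (1 / p) := by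
      calc ENNReal.ofReal (4 * T) ^ (1 / p) = (2 * ENNReal.ofReal (2 * T)) ^ (1 / p) := by
            rw [← ENNReal.ofReal_ofNat, ← ENNReal.ofReal_mul zero_le_two]
            congr 2; ring
        _ ≤ (2 * N) ^ (1 / p) := by gcongr
        _ = 2 ^ (1 / p) * N ^ (1 / p) := ENNReal.mul_rpow_of_nonneg _ _ (by positivity)
        _ ≤ 2 ^ (1 : ℝ) * N ^ (1 / p) := by
            gcongr
            · norm_num
            · rw [div_le_one hp0]; exact hp.le
        _ = _ := by rw [ENNReal.rpow_one]
    refine (ENNReal.mul_le_mul_iff_left hN0 hNT).1 ?_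
    calc c * N ≤ S * (hardyInt p α * (N ^ (1 / p) +
          2 * (ENNReal.ofReal (L / (T * β)) * ENNReal.ofReal (4 * T) ^ (1 / p))) ^ p) :=
          h1.trans (by gcongr)
      _ ≤ S * (hardyInt p α * (N ^ (1 / p) +
          2 * (ENNReal.ofReal (L / (T * β)) * (2 * N ^ (1 / p)))) ^ p) := by gcongr
      _ = S * (hardyInt p α * ((1 + 4 * ENNReal.ofReal (L / (T * β))) * N ^ (1 / p)) ^ p) := by
          congr 3; ring
      _ = _ := by
          rw [ENNReal.mul_rpow_of_nonneg _ _ hp0.le, ← ENNReal.rpow_mul,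
            one_div_mul_cancel hp0.ne', ENNReal.rpow_one]
          ring
  have hlim : Filter.Tendsto (fun T : ℝ =>
      S * hardyInt p α * (1 + 4 * ENNReal.ofReal (L / (T * β))) ^ p) Filter.atTop
      (nhds (S * hardyInt p α * (1 + 4 * ENNReal.ofReal 0) ^ p)) := by
    refine ENNReal.Tendsto.const_mul ?_ (Or.inr hST)
    refine (ENNReal.continuous_rpow_const.tendsto _).comp (Filter.Tendsto.const_add _ ?_)
    refine ENNReal.Tendsto.const_mul (ENNReal.tendsto_ofReal ?_) (Or.inr ENNReal.ofNat_ne_top)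
    exact tendsto_const_nhds.div_atTop (Filter.tendsto_id.atTop_mul_const hβ0)
  have h0 := ge_of_tendsto hlim ((Filter.eventually_gt_atTop 0).mono key)
  simpa using h0

/-- Sharpness on the half-space. -/
theorem le_hardyConst_of_halfSpace [NeZero n] (hp : 1 < p) (hα : 1 < α) (hαp : α < p) (i : Fin n)
    {c : ℝ≥0∞}
    (h : ∀ F : Space n → ℝ, ContDiff ℝ (⊤ : ℕ∞) F → HasCompactSupport F →
      tsupport F ⊆ {x | 0 < x i} →
      c * ∫⁻ x in {x : Space n | 0 < x i}, ‖F x‖ₑ ^ p * ENNReal.ofReal ((x i) ^ (-α)) ≤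
        energy p α {x | 0 < x i} F) :
    c ≤ ENNReal.ofReal (hardyConst n p α) := by
  have hS := ofReal_hardyConst (n := n) hα hαp (e := EuclideanSpace.single i (1 : ℝ)) (by simp)
  rw [← lintegral_sphere_abs_coord] at hS
  rw [hS]
  refine le_of_halfLine hp hα (by rw [← hS]; exact ENNReal.ofReal_ne_top) fun g hg hc hs => ?_
  exact halfLine_of_halfSpace hp (by linarith) hαp i h hg hc hs

end FracHardy

/-! ### Transplanting half-space functions into convex sets. -/

namespace FracHardy

variable {𝕜 : Type*} [RCLike 𝕜] {p α : ℝ} {n : ℕ}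

/-- `T` sends the boundary point `z` to the origin and the normal `e` to the `i`-th axis, and
magnifies by `ε⁻¹`. -/
theorem exists_similarity (i : Fin n) (z : Space n) {e : Space n} (he : ‖e‖ = 1) {ε : ℝ}
    (hε : 0 < ε) :
    ∃ T : Space n ≃ₜ Space n, ContDiff ℝ (⊤ : ℕ∞) T ∧ T z = 0 ∧
      (∀ x y, ‖T x - T y‖ = ε⁻¹ * ‖x - y‖) ∧ (∀ x, T x i = ε⁻¹ * inner ℝ e (x - z)) ∧
      ∀ H : Space n → ℝ≥0∞, ∫⁻ x, H (T x) = ENNReal.ofReal (ε ^ n) * ∫⁻ x, H x := by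
  obtain ⟨b, rfl⟩ := exists_orthonormalBasis_apply_eq i he
  have hε' : ε⁻¹ ≠ 0 := inv_ne_zero hε.ne'
  let T : Space n ≃ₜ Space n := (Homeomorph.subRight z).trans
    (b.repr.toHomeomorph.trans (Homeomorph.smulOfNeZero ε⁻¹ hε'))
  have hT : ∀ x, T x = ε⁻¹ • b.repr (x - z) := fun x => rfl
  refine ⟨T, ?_, by simp [hT], fun x y => ?_, fun x => ?_, fun H => ?_⟩
  · exact ContDiff.const_smul ε⁻¹ (b.repr.toContinuousLinearEquiv.contDiff.comp
      (contDiff_id.sub contDiff_const))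
  · rw [hT, hT, ← smul_sub, ← map_sub, sub_sub_sub_cancel_right, norm_smul, b.repr.norm_map,
      Real.norm_of_nonneg (inv_nonneg.2 hε.le)]
  · rw [hT, PiLp.smul_apply, b.repr_apply_apply, smul_eq_mul]
  · simp only [hT]
    rw [lintegral_sub_right_eq_self (fun x => H (ε⁻¹ • b.repr x)) z,
      lintegral_comp_repr b fun x => H (ε⁻¹ • x)]
    have h := (Homeomorph.smulOfNeZero (α := Space n) ε⁻¹ hε').measurableEmbedding.lintegral_map
      (μ := volume) H
    rw [show ⇑(Homeomorph.smulOfNeZero (α := Space n) ε⁻¹ hε') = (ε⁻¹ • ·) from rfl,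
      Measure.map_addHaar_smul _ hε', lintegral_smul_measure, finrank_euclideanSpace,
      Fintype.card_fin, inv_pow, inv_inv, abs_of_pos (by positivity)] at h
    exact h.symm

theorem enorm_ofReal_eq (r : ℝ) : ‖(r : 𝕜)‖ₑ = ‖r‖ₑ := by
  rw [← ofReal_norm, ← ofReal_norm, RCLike.norm_ofReal, Real.norm_eq_abs]

/-- Two volume factors `ε^n` and the kernel factor `ε^(-(n+α))` combine to `ε^(n-α)`; enlarging the
image of `Ω` to `H` only adds energy. -/
theorem energy_comp_similarity_le {T : Space n ≃ₜ Space n} {ε : ℝ} (hε : 0 < ε)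
    (hnorm : ∀ x y, ‖T x - T y‖ = ε⁻¹ * ‖x - y‖)
    (hint : ∀ H : Space n → ℝ≥0∞, ∫⁻ x, H (T x) = ENNReal.ofReal (ε ^ n) * ∫⁻ x, H x)
    (hα : 0 < α) {Ω H : Set (Space n)} (hΩ : MeasurableSet Ω) (hH : MeasurableSet H)
    (hΩH : ∀ x ∈ Ω, T x ∈ H) {F : Space n → ℝ} (hF : Measurable F) :
    energy p α Ω (fun x => (F (T x) : 𝕜)) ≤
      ENNReal.ofReal (ε ^ (-α)) * ENNReal.ofReal (ε ^ n) * energy p α H F := by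
  set K : Space n × Space n → ℝ≥0∞ := (H ×ˢ H).indicator
    (fun z => ‖F z.1 - F z.2‖ₑ ^ p / ‖z.1 - z.2‖ₑ ^ ((n : ℝ) + α)) with hK
  have hKm : Measurable K := Measurable.indicator (by fun_prop) (hH.prod hH)
  have hnα : 0 < (n : ℝ) + α := by positivity
  have h1 : energy p α Ω (fun x => (F (T x) : 𝕜)) ≤ ∫⁻ z : Space n × Space n,
      ENNReal.ofReal (ε ^ (-((n : ℝ) + α))) * K (T z.1, T z.2) ∂(volume.prod volume) := by
    rw [energy, ← lintegral_indicator (hΩ.prod hΩ)]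
    refine lintegral_mono fun z => ?_
    by_cases hz : z ∈ Ω ×ˢ Ω
    · rw [Set.indicator_of_mem hz, hK, Set.indicator_of_mem
        (show (T z.1, T z.2) ∈ H ×ˢ H from ⟨hΩH _ hz.1, hΩH _ hz.2⟩), ← RCLike.ofReal_sub,
        enorm_ofReal_eq, ← ofReal_norm (T z.1 - T z.2), hnorm, ENNReal.ofReal_mul (by positivity),
        ofReal_norm, ENNReal.mul_rpow_of_nonneg _ _ hnα.le,
        ENNReal.ofReal_rpow_of_pos (by positivity), Real.inv_rpow hε.le, ← Real.rpow_neg hε.le]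
      have h0 : 0 < ε ^ (-((n : ℝ) + α)) := by positivity
      rw [← mul_div_assoc, ENNReal.mul_div_mul_left _ _ (by simpa using h0) ENNReal.ofReal_ne_top]
    · rw [Set.indicator_of_notMem hz]
      exact zero_le
  refine h1.trans_eq ?_
  have hTm : Measurable T := T.continuous.measurable
  have hKT : Measurable fun z : Space n × Space n => K (T z.1, T z.2) :=
    hKm.comp (by fun_prop)
  rw [lintegral_const_mul _ hKT, lintegral_prod _ hKT.aemeasurable]
  have h2 : ∀ x, ∫⁻ y, K (T x, T y) = ENNReal.ofReal (ε ^ n) * ∫⁻ y, K (T x, y) := fun x =>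
    hint fun y => K (T x, y)
  simp only [h2]
  rw [lintegral_const_mul' _ _ ENNReal.ofReal_ne_top, hint fun x => ∫⁻ y, K (x, y),
    ← lintegral_prod _ hKm.aemeasurable, lintegral_indicator (hH.prod hH), ← energy, ← mul_assoc,
    ← mul_assoc, ← ENNReal.ofReal_mul (by positivity), ← Real.rpow_natCast, ← Real.rpow_add hε]
  congr 4
  ring

/-- The weighted norm scales by the same `ε^(n-α)`, and the distance to the boundary is at most the
distance to the supporting hyperplane. -/
theorem le_weightedNorm_comp_similarity {T : Space n ≃ₜ Space n} {ε : ℝ} (hε : 0 < ε)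
    {i : Fin n} {z e : Space n} (he : ‖e‖ = 1) (hp : 0 < p) (hα : 0 < α)
    (hcoord : ∀ x, T x i = ε⁻¹ * inner ℝ e (x - z))
    (hint : ∀ H : Space n → ℝ≥0∞, ∫⁻ x, H (T x) = ENNReal.ofReal (ε ^ n) * ∫⁻ x, H x)
    {Ω : Set (Space n)} (hΩ : MeasurableSet Ω) (hside : ∀ y ∈ Ω, 0 < inner ℝ e (y - z))
    {F : Space n → ℝ} (hF : ∀ x ∉ Ω, F (T x) = 0) :
    ENNReal.ofReal (ε ^ (-α)) * ENNReal.ofReal (ε ^ n) *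
        ∫⁻ x in {x : Space n | 0 < x i}, ‖F x‖ₑ ^ p * ENNReal.ofReal ((x i) ^ (-α)) ≤
      weightedNorm p Ω (dWeight α Ω) (fun x => (F (T x) : 𝕜)) := by
  rw [← lintegral_indicator (measurableSet_halfSpace i), mul_assoc, ← hint,
    ← lintegral_const_mul' _ _ ENNReal.ofReal_ne_top, weightedNorm, ← lintegral_indicator hΩ]
  refine lintegral_mono fun x => ?_
  by_cases hx : x ∈ Ω
  · have hs := hside x hx
    have hTx : 0 < T x i := by rw [hcoord]; positivity
    rw [Set.indicator_of_mem hx, Set.indicator_of_mem (by exact hTx), enorm_ofReal_eq, mul_left_comm]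
    gcongr
    rw [← ENNReal.ofReal_mul (by positivity), ← Real.mul_rpow hε.le hTx.le, hcoord,
      mul_inv_cancel_left₀ hε.ne', dWeight, Real.rpow_neg hs.le,
      ENNReal.ofReal_inv_of_pos (by positivity), ← ENNReal.ofReal_rpow_of_pos hs, one_div,
      ENNReal.inv_le_inv]
    gcongr
    exact infEDist_frontier_le_inner he hside hx
  · have h0 : ∀ x, F x = 0 → {x : Space n | 0 < x i}.indicator
        (fun x => ‖F x‖ₑ ^ p * ENNReal.ofReal ((x i) ^ (-α))) x = 0 := by
      intro x hx
      simp [Set.indicator, hx, hp]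
    rw [h0 _ (hF x hx), mul_zero]
    exact zero_le

/-- The inequality says that `ε x` lies in the ball of radius `d` tangent at the origin to the
hyperplane where the `i`-th coordinate vanishes. A compact set inside the half-space enters this
ball once shrunk enough. -/
theorem exists_scale {d : ℝ} (hd : 0 < d) {i : Fin n} {K : Set (Space n)} (hK : IsCompact K)
    (hKi : K ⊆ {x | 0 < x i}) :
    ∃ ε > 0, ∀ x ∈ K, ε * ‖x‖ ^ 2 < 2 * d * x i := by
  obtain ⟨B, hB⟩ := hK.isBounded.exists_norm_le
  obtain ⟨δ, hδ, hKδ⟩ : ∃ δ > 0, ∀ x ∈ K, δ ≤ x i := by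
    rcases K.eq_empty_or_nonempty with rfl | hne
    · exact ⟨1, one_pos, by simp⟩
    · obtain ⟨x, hx, hmin⟩ := hK.exists_isMinOn hne (f := fun x : Space n => x i) (by fun_prop)
      exact ⟨x i, hKi hx, fun y hy => hmin hy⟩
  refine ⟨d * δ / (B ^ 2 + 1), by positivity, fun x hx => ?_⟩
  have h1 : ‖x‖ ^ 2 ≤ B ^ 2 + 1 := by
    nlinarith [hB x hx, norm_nonneg x]
  calc d * δ / (B ^ 2 + 1) * ‖x‖ ^ 2 ≤ d * δ / (B ^ 2 + 1) * (B ^ 2 + 1) := by gcongr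
    _ = d * δ := by field_simp
    _ < 2 * (d * δ) := by linarith [mul_pos hd hδ]
    _ ≤ 2 * d * x i := by rw [mul_assoc]; gcongr; exact hKδ x hx

/-- A Hardy inequality with the distance to the boundary on one convex set implies the same
inequality on a half-space. -/
theorem halfSpace_of_convex (hp : 0 < p) (hα : 0 < α) (i : Fin n) {Ω : Opens (Space n)}
    (hne : (Ω : Set (Space n)).Nonempty) (hconv : Convex ℝ (Ω : Set (Space n)))
    (hfr : (frontier (Ω : Set (Space n))).Nonempty) {c : ℝ≥0∞}
    (h : ∀ f : 𝓓(Ω, 𝕜), c * weightedNorm p Ω (dWeight α Ω) f ≤ energy p α Ω f)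
    {F : Space n → ℝ} (hF : ContDiff ℝ (⊤ : ℕ∞) F) (hc : HasCompactSupport F)
    (hs : tsupport F ⊆ {x | 0 < x i}) :
    c * ∫⁻ x in {x : Space n | 0 < x i}, ‖F x‖ₑ ^ p * ENNReal.ofReal ((x i) ^ (-α)) ≤
        energy p α {x | 0 < x i} F := by
  obtain ⟨x, hx⟩ := hne
  obtain ⟨z, e, d, hd, he, hxz, hball, hside, -⟩ := exists_nearest_supporting Ω.isOpen hconv hfr hx
  obtain ⟨ε, hε, hscale⟩ := exists_scale hd hc.isCompact hs
  obtain ⟨T, hT, hTz, hnorm, hcoord, hint⟩ := exists_similarity i z he hε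
  -- The shrunken support lies in the ball about `x` of radius `d`: expanding `‖(y - z) - d e‖² <
  -- d²` gives the condition of `exists_scale`.
  have hsub : T ⁻¹' tsupport F ⊆ Ω := by
    intro y hy
    apply hball
    have h1 := hscale _ hy
    have h2 := hnorm y z
    rw [hTz, sub_zero] at h2
    rw [h2, hcoord] at h1
    rw [Metric.mem_ball, dist_eq_norm, hxz, ← sub_sub, ← sq_lt_sq₀ (norm_nonneg _) hd.le,
      norm_sub_sq_real, inner_smul_right, norm_smul, he, mul_one, Real.norm_of_nonneg hd.le,
      real_inner_comm]
    have h3 : ε * (ε⁻¹ * ‖y - z‖) ^ 2 = ε⁻¹ * ‖y - z‖ ^ 2 := by field_simp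
    rw [h3, mul_left_comm, mul_lt_mul_iff_right₀ (inv_pos.2 hε)] at h1
    linarith
  have hsupp : tsupport (fun y => (F (T y) : 𝕜)) ⊆ T ⁻¹' tsupport F := by
    refine closure_minimal (fun y hy => subset_tsupport F fun h0 => hy ?_)
      ((isClosed_tsupport F).preimage T.continuous)
    simp only [h0, RCLike.ofReal_zero]
  let f : 𝓓(Ω, 𝕜) :=
    { toFun := fun y => (F (T y) : 𝕜)
      contDiff' := (RCLike.ofRealCLM (K := 𝕜)).contDiff.comp (hF.comp hT)
      hasCompactSupport' := by
        refine HasCompactSupport.of_support_subset_isCompact (K := T ⁻¹' tsupport F) ?_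
          ((subset_tsupport _).trans hsupp)
        exact T.isCompact_preimage.2 hc.isCompact
      tsupport_subset' := hsupp.trans hsub }
  have h1 := h f
  have h2 := energy_comp_similarity_le (𝕜 := 𝕜) (p := p) (α := α) hε hnorm hint hα
    Ω.isOpen.measurableSet (measurableSet_halfSpace i)
    (fun y hy => by
      show 0 < T y i
      have := hside y hy
      rw [hcoord]
      positivity) hF.continuous.measurable
  have h3 := le_weightedNorm_comp_similarity (𝕜 := 𝕜) (p := p) (α := α) hε he hp hα hcoord hint
    Ω.isOpen.measurableSet hside (F := F)
    (fun y hy => image_eq_zero_of_notMem_tsupport fun hy' => hy (hsub hy'))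
  have h4 : ENNReal.ofReal (ε ^ (-α)) * ENNReal.ofReal (ε ^ n) ≠ 0 := by
    rw [← ENNReal.ofReal_mul (by positivity), Ne, ENNReal.ofReal_eq_zero, not_le]
    positivity
  refine (ENNReal.mul_le_mul_iff_right h4
    (ENNReal.mul_ne_top ENNReal.ofReal_ne_top ENNReal.ofReal_ne_top)).1 ?_
  rw [mul_left_comm]
  exact ((mul_le_mul_right h3 c).trans h1).trans h2

theorem le_hardyConst_of_convex [NeZero n] (hp : 1 < p) (hα : 1 < α) (hαp : α < p)
    {Ω : Opens (Space n)} (hne : (Ω : Set (Space n)).Nonempty)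
    (hconv : Convex ℝ (Ω : Set (Space n))) (hfr : (frontier (Ω : Set (Space n))).Nonempty) {C : ℝ}
    (h : ∀ f : 𝓓(Ω, 𝕜),
      ENNReal.ofReal C * weightedNorm p Ω (dWeight α Ω) f ≤ energy p α Ω f) :
    C ≤ hardyConst n p α := by
  -- Nonnegativity of `hardyConst` handles negative `C`, which `ENNReal.ofReal` truncates to `0`.
  rw [← ENNReal.ofReal_le_ofReal_iff (hardyConst_nonneg hα)]
  exact le_hardyConst_of_halfSpace hp hα hαp ⊤ fun F hF hc hs =>
    halfSpace_of_convex (by linarith) (by linarith) ⊤ hne hconv hfr h hF hc hs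

theorem le_hardyConst_of_convex_mWeight [NeZero n] (hp : 1 < p) (hα : 1 < α) (hαp : α < p)
    {Ω : Opens (Space n)} (hne : (Ω : Set (Space n)).Nonempty)
    (hconv : Convex ℝ (Ω : Set (Space n))) (hfr : (frontier (Ω : Set (Space n))).Nonempty) {C : ℝ}
    (h : ∀ f : 𝓓(Ω, 𝕜),
      ENNReal.ofReal C * weightedNorm p Ω (mWeight α Ω) f ≤ energy p α Ω f) :
    C ≤ hardyConst n p α :=
  le_hardyConst_of_convex (𝕜 := 𝕜) hp hα hαp hne hconv hfr fun f =>
    (mul_le_mul_right (weightedNorm_dWeight_le hα Ω.isOpen hconv f) _).trans (h f)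

/-- The open half-space where the coordinate `i` is positive. -/
def halfSpace (i : Fin n) : Opens (Space n) :=
  ⟨{x | 0 < x i}, isOpen_lt continuous_const (by fun_prop)⟩

theorem halfSpace_nonempty (i : Fin n) : (halfSpace i : Set (Space n)).Nonempty :=
  ⟨EuclideanSpace.single i 1, by simp [halfSpace]⟩

theorem convex_halfSpace (i : Fin n) : Convex ℝ (halfSpace i : Set (Space n)) :=
  (convex_Ioi (0 : ℝ)).linear_preimage (EuclideanSpace.proj (𝕜 := ℝ) i).toLinearMap

theorem frontier_halfSpace_nonempty (i : Fin n) :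
    (frontier (halfSpace i : Set (Space n))).Nonempty := by
  rw [nonempty_frontier_iff]
  refine ⟨halfSpace_nonempty i, fun h => ?_⟩
  have : (0 : Space n) ∈ (halfSpace i : Set (Space n)) := by rw [h]; trivial
  simp [halfSpace] at this

end FracHardy
theorem mainTheorem2 {𝕜 : Type*} [RCLike 𝕜] {n : ℕ} [NeZero n] {p α : ℝ}
    (hp : 1 < p) (hα : 1 < α) (hαp : α < p) :
    -- the inequality on every domain
    (∀ Ω : Opens (FracHardy.Space n), IsConnected (Ω : Set (FracHardy.Space n)) →
      ∀ f : 𝓓(Ω, 𝕜),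
        ENNReal.ofReal (FracHardy.hardyConst n p α) *
            FracHardy.weightedNorm p Ω (FracHardy.mWeight α Ω) f
          ≤ FracHardy.energy p α Ω f) ∧
    -- no larger constant works for all domains
    (∀ C : ℝ,
      (∀ Ω : Opens (FracHardy.Space n), IsConnected (Ω : Set (FracHardy.Space n)) →
        ∀ f : 𝓓(Ω, 𝕜),
          ENNReal.ofReal C * FracHardy.weightedNorm p Ω (FracHardy.mWeight α Ω) f
            ≤ FracHardy.energy p α Ω f) →
      C ≤ FracHardy.hardyConst n p α) ∧
    -- the inequality on every convex domain, with the distance to the boundary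
    (∀ Ω : Opens (FracHardy.Space n), (Ω : Set (FracHardy.Space n)).Nonempty →
      Convex ℝ (Ω : Set (FracHardy.Space n)) →
      ∀ f : 𝓓(Ω, 𝕜),
        ENNReal.ofReal (FracHardy.hardyConst n p α) *
            FracHardy.weightedNorm p Ω (FracHardy.dWeight α Ω) f
          ≤ FracHardy.energy p α Ω f) ∧
    -- on each convex domain with non-empty boundary, no larger constant works for either weight
    (∀ Ω : Opens (FracHardy.Space n), (Ω : Set (FracHardy.Space n)).Nonempty →
      Convex ℝ (Ω : Set (FracHardy.Space n)) →
      (frontier (Ω : Set (FracHardy.Space n))).Nonempty →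
      ∀ C : ℝ,
        ((∀ f : 𝓓(Ω, 𝕜),
            ENNReal.ofReal C * FracHardy.weightedNorm p Ω (FracHardy.mWeight α Ω) f
              ≤ FracHardy.energy p α Ω f) →
          C ≤ FracHardy.hardyConst n p α) ∧
        ((∀ f : 𝓓(Ω, 𝕜),
            ENNReal.ofReal C * FracHardy.weightedNorm p Ω (FracHardy.dWeight α Ω) f
              ≤ FracHardy.energy p α Ω f) →
          C ≤ FracHardy.hardyConst n p α)) := by
  have h1 : ∀ (Ω : Opens (FracHardy.Space n)) (f : 𝓓(Ω, 𝕜)),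
      ENNReal.ofReal (FracHardy.hardyConst n p α) *
        FracHardy.weightedNorm p Ω (FracHardy.mWeight α Ω) f ≤ FracHardy.energy p α Ω f :=
    fun Ω f => FracHardy.hardy_mWeight hp hα hαp Ω.isOpen f.continuous f.hasCompactSupport
      f.tsupport_subset
  refine ⟨fun Ω _ f => h1 Ω f, fun C hC => ?_, fun Ω _ hconv f => ?_,
    fun Ω hne hconv hfr C => ⟨fun h => ?_, fun h => ?_⟩⟩
  -- A single convex domain with boundary suffices for sharpness over all domains; the half-space is
  -- one.
  · have hne := FracHardy.halfSpace_nonempty (⊤ : Fin n)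
    have hconv := FracHardy.convex_halfSpace (⊤ : Fin n)
    exact FracHardy.le_hardyConst_of_convex_mWeight (𝕜 := 𝕜) hp hα hαp hne hconv
      (FracHardy.frontier_halfSpace_nonempty ⊤) (hC _ ⟨hne, hconv.isPreconnected⟩)
  · exact (mul_le_mul_right (FracHardy.weightedNorm_dWeight_le hα Ω.isOpen hconv f) _).trans (h1 Ω f)
  · exact FracHardy.le_hardyConst_of_convex_mWeight hp hα hαp hne hconv hfr h
  · exact FracHardy.le_hardyConst_of_convex hp hα hαp hne hconv hfr h
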